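/- **Explicit VIX formula in the quintic Ornstein–Uhlenbeck volatility model.** Let $(W,W^\perp)$ be a two-dimensional Brownian motion on a filtered probability space $(\Omega,\mathcal F,(\mathcal F_t)_{t\ge0},\mathbb Q)$, and let $\varepsilon>0$, $H\in(-\infty,1/2]$, $\rho\in[-1,1]$, $\alpha_0,\alpha_1,\alpha_3,\alpha_5\ge 0$ not all zero, $\alpha_2=\alpha_4=0$ and $\alpha_k=0$ for $k>5$. Let $\xi_0:[0,\infty)\to[0,\infty)$ be square-integrable on every bounded interval. Put $\lambda=(1/2-H)\varepsilon^{-1}$, $p(x)=\sum_{k=0}^5\alpha_kx^k$, $B=\rho W+\sqrt{1-\rho^2}\,W^\perp$ and $$X_t=\varepsilon^{H-1/2}\int_0^te^{-\lambda(t-s)}dW_s,\qquad g(t)=\mathbb E[p(X_t)^2],\qquad \sigma_t=\sqrt{\xi_0(t)}\,\frac{p(X_t)}{\sqrt{g(t)}},$$ and let $dS_t/S_t=\sigma_t\,dB_t$, that is, $S_t=S_0\exp\big(\int_0^t\sigma_s\,dB_s-\tfrac12\int_0^t\sigma_s^2\,ds\big)$ with $S_0>0$. Fix $\Delta>0$ and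 $T\ge0$, with $\alpha_0>0$ if $T=0$. Define $$\mathrm{VIX}_T^2=-\frac{2}{\Delta}\,\mathbb E\big[\log(S_{T+\Delta}/S_T)\,\big|\,\mathcal F_T\big]\times100^2,\qquad \mathrm{VIX}_T=\sqrt{\mathrm{VIX}_T^2},\qquad \xi_T(u)=\mathbb E[\sigma_u^2\mid\mathcal F_T],\qquad G_T^u=X_u-e^{-\lambda(u-T)}X_T\quad(u\ge T).$$ Let $v(\tau)=\frac{\varepsilon^{2H}}{1-2H}\big(1-e^{-(1-2H)\varepsilon^{-1}\tau}\big)$ if $H<1/2$ and $v(\tau)=\tau$ if $H=1/2$, and $(\alpha*\alpha)_k=\sum_{j=0}^k\alpha_j\alpha_{k-j}$. Then: 1. For every $u\ge T$, $G_T^u=\varepsilon^{H-1/2}\int_T^ue^{-\lambda(u-s)}dW_s$ a.s., and $G_T^u$ is independent of $\mathcal F_T$ and has law $\mathcal N(0,v(u-T))$. For $m\in\mathbb N$, $\mathbb E[(G_T^u)^m]$ is $0$ if $m$ is odd and $v(u-T)^{m/2}(m-1)!!$ if $m$ is even, where $(-1)!!=1$. 2. For every $u\ge T$, $g(u)>0$,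 $\sigma_u^2$ is integrable, and the forward variance is a polynomial of degree at most $10$ in $X_T$: a.s. $$\xi_T(u)=\frac{\xi_0(u)}{g(u)}\sum_{k=0}^{10}\sum_{i=0}^{k}(\alpha*\alpha)_k\binom ki\big(X_Te^{-\lambda(u-T)}\big)^i\,\mathbb E\big[(G_T^u)^{k-i}\big].$$ 3. $\log(S_{T+\Delta}/S_T)$ is integrable, the forward variance has a version which is jointly measurable (up to null sets) in $(u,\omega)$ for $u\in(T,T+\Delta]$, every such version is a.s. integrable in $u$ over $(T,T+\Delta]$, and a.s. $$\mathrm{VIX}_T^2=\frac{100^2}{\Delta}\int_T^{T+\Delta}\xi_T(u)\,du=\frac{100^2}{\Delta}\sum_{i=0}^{10}\beta_iX_T^i=:h(X_T),$$ $$\beta_i=\sum_{k=i}^{10}(\alpha*\alpha)_k\binom ki\int_T^{T+\Delta}\frac{\xi_0(u)}{g(u)}\,\mathbb E\big[(G_T^u)^{k-i}\big]\,e^{-\lambda(u-T)i}\,du,$$ where for all $m,i\in\mathbb N$ the function $u\mapsto\frac{\xi_0(u)}{g(u)}\mathbb E[(G_T^u)^m]e^{-\lambda(u-T)i}$ is integrable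 on $(T,T+\Delta]$. 4. $h\ge0$ on $\mathbb R$, $X_T$ has law $\mathcal N(0,\sigma_{X_T}^2)$ with $\sigma_{X_T}^2=v(T)$, and for every Borel function $\Phi:\mathbb R\to\mathbb R$, $\Phi(\mathrm{VIX}_T)$ is integrable if and only if $x\mapsto\Phi\big(\sqrt{h(\sigma_{X_T}x)}\big)e^{-x^2/2}$ is Lebesgue integrable, in which case $$\mathbb E[\Phi(\mathrm{VIX}_T)]=\mathbb E\big[\Phi\big(\sqrt{h(X_T)}\big)\big]=\frac1{\sqrt{2\pi}}\int_{\mathbb R}\Phi\big(\sqrt{h(\sigma_{X_T}x)}\big)e^{-x^2/2}\,dx.$$ -/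

import Mathlib

open MeasureTheory ProbabilityTheory
open scoped NNReal ENNReal Topology

noncomputable section

namespace QuinticOU

/-- Lebesgue measure on the time axis `[0, ∞)`. -/
def timeMeasure : Measure ℝ≥0 :=
  Measure.comap NNReal.toReal volume

variable {Ω : Type*} {mΩ : MeasurableSpace Ω}

/-- `(W, W')` is a two-dimensional standard Brownian motion relative to the filtration `𝓕`:
both coordinates are adapted real Brownian motions started at zero with almost surely continuous
paths, they are independent of each other, and for every `s` the process of future increments
`((W_{s+t} - W_s, W'_{s+t} - W'_s))_{t ≥ 0}` is independent of `𝓕_s`. -/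
structure IsBrownianPair (𝓕 : Filtration ℝ≥0 mΩ) (P : Measure Ω) (W W' : ℝ≥0 → Ω → ℝ) :
    Prop where
  adapted_left : Adapted 𝓕 W
  adapted_right : Adapted 𝓕 W'
  brownian_left : IsBrownianReal W P
  brownian_right : IsBrownianReal W' P
  indep : IndepFun (fun ω t => W t ω) (fun ω t => W' t ω) P
  indep_increments : ∀ s : ℝ≥0,
    Indep (MeasurableSpace.comap
        (fun ω (t : ℝ≥0) => (W (s + t) ω - W s ω, W' (s + t) ω - W' s ω)) inferInstance)
      (𝓕 s) P

/-- A simple predictable process on the time interval `(a, b]`: a finite linear combination of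
terms `c i * 1_{(s i, t i]}` with `a ≤ s i ≤ t i ≤ b` and `c i` bounded and `𝓕_{s i}`-measurable.
(The intervals are not required to be disjoint; this describes the same class of processes.) -/
structure SimpleProcess (𝓕 : Filtration ℝ≥0 mΩ) (a b : ℝ≥0) where
  n : ℕ
  s : Fin n → ℝ≥0
  t : Fin n → ℝ≥0
  c : Fin n → Ω → ℝ
  le_left : ∀ i, a ≤ s i
  le_mid : ∀ i, s i ≤ t i
  le_right : ∀ i, t i ≤ b
  measurable_coeff : ∀ i, Measurable[𝓕 (s i)] (c i)
  bounded_coeff : ∀ i, ∃ C : ℝ, ∀ ω, |c i ω| ≤ C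

/-- The value at time `r` of a simple process. -/
def SimpleProcess.eval {𝓕 : Filtration ℝ≥0 mΩ} {a b : ℝ≥0} (φ : SimpleProcess 𝓕 a b)
    (r : ℝ≥0) (ω : Ω) : ℝ :=
  ∑ i, (Set.Ioc (φ.s i) (φ.t i)).indicator (fun _ => φ.c i ω) r

/-- The elementary stochastic integral `∫_a^b φ dB` of a simple process. -/
def SimpleProcess.integral {𝓕 : Filtration ℝ≥0 mΩ} {a b : ℝ≥0} (φ : SimpleProcess 𝓕 a b)
    (B : ℝ≥0 → Ω → ℝ) (ω : Ω) : ℝ :=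
  ∑ i, φ.c i ω * (B (φ.t i) ω - B (φ.s i) ω)

/-- `Y` is (a version of) the Itô integral `∫_a^b f dB` of the process `f`, square-integrable for
`dt ⊗ P` on `(a, b]`: there are simple processes converging to `f` in `L²((a, b] × Ω)` whose
elementary integrals converge to `Y` in `L²(P)`. -/
def IsItoIntegral (𝓕 : Filtration ℝ≥0 mΩ) (P : Measure Ω) (B : ℝ≥0 → Ω → ℝ) (a b : ℝ≥0)
    (f : ℝ≥0 → Ω → ℝ) (Y : Ω → ℝ) : Prop :=
  MemLp (Function.uncurry f) 2 ((timeMeasure.restrict (Set.Ioc a b)).prod P) ∧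
  MemLp Y 2 P ∧
  ∃ φ : ℕ → SimpleProcess 𝓕 a b,
    Filter.Tendsto
      (fun n => eLpNorm (fun z : ℝ≥0 × Ω => (φ n).eval z.1 z.2 - f z.1 z.2) 2
        ((timeMeasure.restrict (Set.Ioc a b)).prod P)) Filter.atTop (𝓝 0) ∧
    Filter.Tendsto
      (fun n => eLpNorm (fun ω => (φ n).integral B ω - Y ω) 2 P) Filter.atTop (𝓝 0)

/-- The parameters of the quintic Ornstein-Uhlenbeck volatility model, with their constraints.
The polynomial `p` is not identically zero, since the model divides by `E[p(X_t)²]`. -/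
structure Params where
  ε : ℝ
  H : ℝ
  ρ : ℝ
  α₀ : ℝ
  α₁ : ℝ
  α₃ : ℝ
  α₅ : ℝ
  /-- the input curve -/
  ξ₀ : ℝ≥0 → ℝ
  ε_pos : 0 < ε
  H_le : H ≤ 1 / 2
  ρ_mem : ρ ∈ Set.Icc (-1 : ℝ) 1
  α₀_nonneg : 0 ≤ α₀
  α₁_nonneg : 0 ≤ α₁
  α₃_nonneg : 0 ≤ α₃
  α₅_nonneg : 0 ≤ α₅
  α_ne_zero : ¬ (α₀ = 0 ∧ α₁ = 0 ∧ α₃ = 0 ∧ α₅ = 0)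
  ξ₀_nonneg : ∀ t, 0 ≤ ξ₀ t
  ξ₀_memLp : ∀ t : ℝ≥0, MemLp ξ₀ 2 (timeMeasure.restrict (Set.Icc 0 t))

namespace Params

variable (θ : Params)

/-- The coefficients `α_k` of the quintic polynomial, with `α_2 = α_4 = 0` and `α_k = 0` for
`k > 5`. -/
def α : ℕ → ℝ
  | 0 => θ.α₀
  | 1 => θ.α₁
  | 3 => θ.α₃
  | 5 => θ.α₅
  | _ => 0

/-- The quintic polynomial `p(x) = α_0 + α_1 x + α_3 x³ + α_5 x⁵`. -/
def p (x : ℝ) : ℝ :=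
  θ.α₀ + θ.α₁ * x + θ.α₃ * x ^ 3 + θ.α₅ * x ^ 5

/-- The discrete convolution `(α * α)_k = ∑_{j=0}^k α_j α_{k-j}`. -/
def conv (k : ℕ) : ℝ :=
  ∑ j ∈ Finset.range (k + 1), θ.α j * θ.α (k - j)

/-- The speed of mean reversion `(1/2 - H) ε⁻¹`. -/
def speed : ℝ :=
  (1 / 2 - θ.H) * θ.ε⁻¹

/-- The kernel `ε^{H - 1/2} e^{-(1/2-H) ε⁻¹ (t - s)}` of the Ornstein-Uhlenbeck process. -/
def kernel (t s : ℝ≥0) : ℝ :=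
  θ.ε ^ (θ.H - 1 / 2) * Real.exp (-θ.speed * ((t : ℝ) - s))

/-- The variance `ε^{2H} / (1 - 2H) * (1 - e^{-(1-2H) ε⁻¹ τ})` of an increment over a time
span `τ`; for `H = 1/2` it is the limiting value `τ`. -/
def variance (τ : ℝ) : ℝ :=
  if θ.H = 1 / 2 then τ
  else θ.ε ^ (2 * θ.H) / (1 - 2 * θ.H) * (1 - Real.exp (-(1 - 2 * θ.H) * θ.ε⁻¹ * τ))

/-- `X` is the Ornstein-Uhlenbeck process `X_t = ε^{H-1/2} ∫_0^t e^{-(1/2-H) ε⁻¹ (t-s)} dW_s`. -/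
def IsOU (𝓕 : Filtration ℝ≥0 mΩ) (P : Measure Ω) (W X : ℝ≥0 → Ω → ℝ) : Prop :=
  ∀ t : ℝ≥0, IsItoIntegral 𝓕 P W 0 t (fun s _ => θ.kernel t s) (X t)

/-- The Brownian motion `B = ρ W + √(1 - ρ²) W'` driving the stock price. -/
def mixedBM (W W' : ℝ≥0 → Ω → ℝ) (t : ℝ≥0) (ω : Ω) : ℝ :=
  θ.ρ * W t ω + Real.sqrt (1 - θ.ρ ^ 2) * W' t ω

/-- The normalization `g(u) = E[p(X_u)²]`. -/
def g (P : Measure Ω) (X : ℝ≥0 → Ω → ℝ) (u : ℝ≥0) : ℝ :=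
  ∫ ω, θ.p (X u ω) ^ 2 ∂P

/-- The volatility `σ_t = √(ξ_0(t)) p(X_t) / √(E[p(X_t)²])`. -/
def σ (P : Measure Ω) (X : ℝ≥0 → Ω → ℝ) (t : ℝ≥0) (ω : Ω) : ℝ :=
  Real.sqrt (θ.ξ₀ t) * (θ.p (X t ω) / Real.sqrt (θ.g P X t))

/-- `S` is the stock price with `dS_t / S_t = σ_t dB_t`, that is,
`S_t = S_0 exp(∫_0^t σ_s dB_s - (1/2) ∫_0^t σ_s² ds)` with `S_0 > 0`. -/
def IsStockPrice (𝓕 : Filtration ℝ≥0 mΩ) (P : Measure Ω) (W W' X S : ℝ≥0 → Ω → ℝ) : Prop :=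
  ∃ (S₀ : ℝ) (M : ℝ≥0 → Ω → ℝ), 0 < S₀ ∧
    (∀ t : ℝ≥0, IsItoIntegral 𝓕 P (θ.mixedBM W W') 0 t (θ.σ P X) (M t)) ∧
    ∀ t : ℝ≥0, ∀ᵐ ω ∂P, S t ω =
      S₀ * Real.exp (M t ω - (1 / 2) * ∫ s in Set.Ioc 0 t, θ.σ P X s ω ^ 2 ∂timeMeasure)

/-- `G_T^u = X_u - X_T e^{-(1/2-H) ε⁻¹ (u - T)}`. -/
def G (X : ℝ≥0 → Ω → ℝ) (T u : ℝ≥0) (ω : Ω) : ℝ :=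
  X u ω - X T ω * Real.exp (-θ.speed * ((u : ℝ) - T))

/-- The integrand `ξ_0(u) / g(u) * E[(G_T^u)^m] * e^{-(1/2-H) ε⁻¹ (u - T) i}` in `β_i`. -/
def βIntegrand (P : Measure Ω) (X : ℝ≥0 → Ω → ℝ) (T : ℝ≥0) (m i : ℕ) (u : ℝ≥0) : ℝ :=
  θ.ξ₀ u / θ.g P X u * (∫ ω, θ.G X T u ω ^ m ∂P) *
    Real.exp (-θ.speed * ((u : ℝ) - T) * i)

/-- `β_i = ∑_{k=i}^{10} (α*α)_k (k choose i) ∫_T^{T+Δ} ξ_0(u) / g(u) E[(G_T^u)^{k-i}]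
e^{-(1/2-H) ε⁻¹ (u - T) i} du`. -/
def β (P : Measure Ω) (X : ℝ≥0 → Ω → ℝ) (T Δ : ℝ≥0) (i : ℕ) : ℝ :=
  ∑ k ∈ Finset.Icc i 10, θ.conv k * (k.choose i : ℝ) *
    ∫ u in Set.Ioc T (T + Δ), θ.βIntegrand P X T (k - i) i u ∂timeMeasure

/-- The polynomial `h(x) = (100² / Δ) ∑_{i=0}^{10} β_i x^i`. -/
def h (P : Measure Ω) (X : ℝ≥0 → Ω → ℝ) (T Δ : ℝ≥0) (x : ℝ) : ℝ :=
  100 ^ 2 / (Δ : ℝ) * ∑ i ∈ Finset.range 11, θ.β P X T Δ i * x ^ i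

end Params

/-- Moments of the centered Gaussian law of variance `v`: zero for odd `m`, and
`(√v)^m (m - 1)!!` for even `m` (with `(-1)!! = 1`). -/
def gaussianMoment (v : ℝ) (m : ℕ) : ℝ :=
  if Odd m then 0 else Real.sqrt v ^ m * (Nat.doubleFactorial (m - 1) : ℝ)

/-- `ξ` is a version of the forward variance process `ξ_T(u) = E[σ_u² | 𝓕_T]`, `u ≥ T`, which is
jointly measurable in `(u, ω)` (up to null sets) on the window `(T, T + Δ]`. -/
def IsForwardVariance (𝓕 : Filtration ℝ≥0 mΩ) (P : Measure Ω) (σ : ℝ≥0 → Ω → ℝ) (T Δ : ℝ≥0)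
    (ξ : ℝ≥0 → Ω → ℝ) : Prop :=
  AEStronglyMeasurable (Function.uncurry ξ)
    ((timeMeasure.restrict (Set.Ioc T (T + Δ))).prod P) ∧
  ∀ u : ℝ≥0, T ≤ u → ξ u =ᵐ[P] P[fun ω => σ u ω ^ 2 | 𝓕 T]

/-- `VIX_T² = -(2 / Δ) E[log(S_{T+Δ} / S_T) | 𝓕_T] * 100²`. -/
def vixSq (𝓕 : Filtration ℝ≥0 mΩ) (P : Measure Ω) (S : ℝ≥0 → Ω → ℝ) (T Δ : ℝ≥0) (ω : Ω) : ℝ :=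
  -(2 / (Δ : ℝ)) * (P[fun ω' => Real.log (S (T + Δ) ω' / S T ω') | 𝓕 T]) ω * 100 ^ 2

/-- `VIX_T = √(VIX_T²)`. -/
def vix (𝓕 : Filtration ℝ≥0 mΩ) (P : Measure Ω) (S : ℝ≥0 → Ω → ℝ) (T Δ : ℝ≥0) (ω : Ω) : ℝ :=
  Real.sqrt (vixSq 𝓕 P S T Δ ω)

end QuinticOU

end

/-! The kernel factorises: `exp_mul_kernel` says that the kernel at `u` is `e^{-λ(u-T)}` times the
kernel at `T`. Subtracting `e^{-λ(u-T)} X_T` from `X_u` therefore removes the stochastic integral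
over `(0, T]` and leaves a Wiener integral over `(T, u]`, namely `G_T^u`. This is an L² limit of
linear combinations of increments of `W` after `T`, hence independent of `𝓕_T` and centred Gaussian,
with variance the integral of the squared kernel.

In `p(X_T e^{-λ(u-T)} + G_T^u)²`, expanded binomially, the powers of `X_T` are known at time `T` and
the powers of `G_T^u` are independent of `𝓕_T`. So `condExp_σ_sq` presents the forward variance as a
polynomial in `X_T` whose coefficients contain Gaussian moments. The log-return is an Itô integral
over `(T, T + Δ]` minus half of the integrated `σ²`. The first term vanishes under conditioning
(`IsItoIntegral.setIntegral_eq`), Fubini turns the second into the integrated forward variance, and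
integrating the polynomial in `u` gives `h(X_T)`. Pricing is a change of variables under the law of
`X_T`.

Two facts support this. By the isometry, an Itô integral is the limit along every approximating
sequence (`IsItoIntegral.tendsto`), so step functions can serve for Gaussianity and truncations for
the martingale property. Nonnegative coefficients make `g` positive, and its continuity keeps `ξ₀ /
g` integrable. -/

noncomputable section

namespace QuinticOU

/-! ### Lebesgue measure on the half-line. -/

section Time

lemma measurableEmbedding_toReal : MeasurableEmbedding NNReal.toReal :=
  MeasurableEmbedding.subtype_coe measurableSet_Ici

lemma toReal_image_Ioc (a b : ℝ≥0) :
    NNReal.toReal '' Set.Ioc a b = Set.Ioc (a : ℝ) b := by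
  ext x
  constructor
  · rintro ⟨y, hy, rfl⟩
    exact ⟨by exact_mod_cast hy.1, by exact_mod_cast hy.2⟩
  · rintro ⟨h1, h2⟩
    have hx : 0 ≤ x := a.2.trans h1.le
    exact ⟨⟨x, hx⟩, ⟨by exact_mod_cast h1, by exact_mod_cast h2⟩, rfl⟩

lemma timeMeasure_apply (s : Set ℝ≥0) : timeMeasure s = volume (NNReal.toReal '' s) :=
  measurableEmbedding_toReal.comap_apply _ _

lemma timeMeasure_Ioc (a b : ℝ≥0) : timeMeasure (Set.Ioc a b) = ENNReal.ofReal (b - a) := by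
  rw [timeMeasure_apply, toReal_image_Ioc, Real.volume_Ioc]

instance : SFinite timeMeasure := by
  have : SigmaFinite timeMeasure :=
    ⟨⟨{ set := fun n => NNReal.toReal ⁻¹' Set.Icc (-n : ℝ) n
        set_mem := fun _ => trivial
        finite := fun n => by
          rw [timeMeasure_apply]
          exact (measure_mono (Set.image_preimage_subset _ _)).trans_lt measure_Icc_lt_top
        spanning := by
          refine Set.eq_univ_of_forall fun x => Set.mem_iUnion.mpr ?_
          obtain ⟨n, hn⟩ := exists_nat_ge (x : ℝ)
          exact ⟨n, by linarith [x.2, show (x : ℝ) ≥ 0 from x.2], hn⟩ }⟩⟩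
  infer_instance

instance (a b : ℝ≥0) : IsFiniteMeasure (timeMeasure.restrict (Set.Ioc a b)) :=
  ⟨by simp [timeMeasure_Ioc]⟩

lemma map_toReal_timeMeasure_restrict (a b : ℝ≥0) :
    (timeMeasure.restrict (Set.Ioc a b)).map NNReal.toReal
      = volume.restrict (Set.Ioc (a : ℝ) b) := by
  ext s hs
  rw [measurableEmbedding_toReal.map_apply, Measure.restrict_apply hs,
    Measure.restrict_apply (measurableEmbedding_toReal.measurable hs), timeMeasure_apply]
  congr 1
  rw [Set.image_preimage_inter, toReal_image_Ioc]

lemma setIntegral_timeMeasure (a b : ℝ≥0) (f : ℝ → ℝ) :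
    ∫ r in Set.Ioc a b, f r ∂timeMeasure = ∫ x in Set.Ioc (a : ℝ) b, f x := by
  rw [← map_toReal_timeMeasure_restrict, measurableEmbedding_toReal.integral_map]

end Time

/-! ### Brownian increments and the Itô isometry for simple processes. -/

variable {Ω : Type*} {mΩ : MeasurableSpace Ω}

/-- The second-order properties of a Brownian motion relative to a filtration that yield the Itô
isometry. -/
structure HasBrownianIncrements (𝓕 : Filtration ℝ≥0 mΩ) (P : Measure Ω) (B : ℝ≥0 → Ω → ℝ) :
    Prop where
  adapted : ∀ t, Measurable[𝓕 t] (B t)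
  memLp : ∀ t, MemLp (B t) 2 P
  integral_sub : ∀ s t, s ≤ t → ∫ ω, (B t ω - B s ω) ∂P = 0
  integral_mul : ∀ s t u, s ≤ t → s ≤ u →
    ∫ ω, (B t ω - B s ω) * (B u ω - B s ω) ∂P = min (t : ℝ) u - s
  indep : ∀ s t u, s ≤ t → s ≤ u →
    Indep (MeasurableSpace.comap (fun ω => (B t ω - B s ω, B u ω - B s ω)) inferInstance) (𝓕 s) P

section Isometry

variable {𝓕 : Filtration ℝ≥0 mΩ} {P : Measure Ω} {B : ℝ≥0 → Ω → ℝ}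

lemma HasBrownianIncrements.measurable (hB : HasBrownianIncrements 𝓕 P B) (t : ℝ≥0) :
    Measurable (B t) := (hB.adapted t).mono (𝓕.le t) le_rfl

lemma HasBrownianIncrements.indepFun (hB : HasBrownianIncrements 𝓕 P B) {s t u : ℝ≥0}
    (hst : s ≤ t) (hsu : s ≤ u) {c : Ω → ℝ} (hc : Measurable[𝓕 s] c) {f : ℝ × ℝ → ℝ}
    (hf : Measurable f) :
    IndepFun c (fun ω => f (B t ω - B s ω, B u ω - B s ω)) P := by
  rw [IndepFun_iff_Indep]
  refine (indep_of_indep_of_le_left (indep_of_indep_of_le_right (hB.indep s t u hst hsu)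
    hc.comap_le) ?_).symm
  exact (hf.comp (comap_measurable _)).comap_le

lemma HasBrownianIncrements.integral_mul_sub (hB : HasBrownianIncrements 𝓕 P B) {s t : ℝ≥0}
    (hst : s ≤ t) {c : Ω → ℝ} (hc : Measurable[𝓕 s] c) :
    ∫ ω, c ω * (B t ω - B s ω) ∂P = 0 := by
  have h := (hB.indepFun hst hst hc measurable_fst).integral_fun_mul_eq_mul_integral
    (hc.mono (𝓕.le s) le_rfl).aestronglyMeasurable
    ((hB.measurable t).sub (hB.measurable s)).aestronglyMeasurable
  rw [h, hB.integral_sub s t hst, mul_zero]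

/-- The product of two increments with a common start has to be independent of `c`; this is why the
field `indep` concerns pairs of increments. -/
lemma HasBrownianIncrements.integral_mul_sub_mul_sub (hB : HasBrownianIncrements 𝓕 P B)
    {s t u : ℝ≥0} (hst : s ≤ t) (hsu : s ≤ u) {c : Ω → ℝ} (hc : Measurable[𝓕 s] c) :
    ∫ ω, c ω * ((B t ω - B s ω) * (B u ω - B s ω)) ∂P
      = (∫ ω, c ω ∂P) * (min (t : ℝ) u - s) := by
  have h := (hB.indepFun hst hsu hc (f := fun z => z.1 * z.2)
    (measurable_fst.mul measurable_snd)).integral_fun_mul_eq_mul_integral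
    (hc.mono (𝓕.le s) le_rfl).aestronglyMeasurable
    (((hB.measurable t).sub (hB.measurable s)).mul
      ((hB.measurable u).sub (hB.measurable s))).aestronglyMeasurable
  rw [← hB.integral_mul s t u hst hsu, ← h]

lemma memLp_mul_of_bounded {c X : Ω → ℝ} (hc : Measurable c) {C : ℝ} (hC : ∀ ω, |c ω| ≤ C)
    (hX : MemLp X 2 P) : MemLp (fun ω => c ω * X ω) 2 P :=
  hX.mul' (memLp_top_of_bound hc.aestronglyMeasurable C (ae_of_all _ hC))

lemma integrable_mul_of_memLp {X Y : Ω → ℝ} (hX : MemLp X 2 P) (hY : MemLp Y 2 P) :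
    Integrable (fun ω => X ω * Y ω) P := hX.integrable_mul hY

/-- If the first interval ends before `s₂`, everything but the second increment is `𝓕 s₂`-measurable
and the expectation is zero. Otherwise the first increment is cut at `s₂`: the early piece joins the
coefficients, and only the late piece contributes, through the length of the overlap. -/
lemma HasBrownianIncrements.integral_increment_mul_aux (hB : HasBrownianIncrements 𝓕 P B)
    {s₁ t₁ s₂ t₂ : ℝ≥0} (h₂ : s₂ ≤ t₂) (hs : s₁ ≤ s₂) {c₁ c₂ : Ω → ℝ}
    (hc₁ : Measurable[𝓕 s₁] c₁) (hc₂ : Measurable[𝓕 s₂] c₂) {C₁ C₂ : ℝ}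
    (hC₁ : ∀ ω, |c₁ ω| ≤ C₁) (hC₂ : ∀ ω, |c₂ ω| ≤ C₂) :
    ∫ ω, (c₁ ω * (B t₁ ω - B s₁ ω)) * (c₂ ω * (B t₂ ω - B s₂ ω)) ∂P
      = (∫ ω, c₁ ω * c₂ ω ∂P) * max 0 (min (t₁ : ℝ) t₂ - max (s₁ : ℝ) s₂) := by
  have hm₁ := hc₁.mono (𝓕.le s₁) le_rfl
  have hm₂ := hc₂.mono (𝓕.le s₂) le_rfl
  have hsR : (s₁ : ℝ) ≤ s₂ := hs
  have hc₁' : Measurable[𝓕 s₂] c₁ := hc₁.mono (𝓕.mono hs) le_rfl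
  have hBs : Measurable[𝓕 s₂] (B s₁) := (hB.adapted s₁).mono (𝓕.mono hs) le_rfl
  rcases le_total t₁ s₂ with ht | ht
  · have hBt : Measurable[𝓕 s₂] (B t₁) := (hB.adapted t₁).mono (𝓕.mono ht) le_rfl
    have h := hB.integral_mul_sub h₂ ((hc₁'.mul (hBt.sub hBs)).mul hc₂)
    have ht' : (t₁ : ℝ) ≤ s₂ := ht
    rw [max_eq_left (by rw [max_eq_right hsR]; linarith [min_le_left (t₁ : ℝ) t₂]), mul_zero, ← h]
    refine integral_congr_ae (ae_of_all _ fun ω => ?_)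
    simp only [Pi.mul_apply, Pi.sub_apply]
    ring
  · have ht' : (s₂ : ℝ) ≤ t₁ := ht
    have h₂' : (s₂ : ℝ) ≤ t₂ := h₂
    have e1 := hB.integral_mul_sub h₂ ((hc₁'.mul ((hB.adapted s₂).sub hBs)).mul hc₂)
    have e2 := hB.integral_mul_sub_mul_sub ht h₂ (hc₁'.mul hc₂)
    have hmem (c : Ω → ℝ) (hc : Measurable c) (C : ℝ) (hC : ∀ ω, |c ω| ≤ C) (s t : ℝ≥0) :
        MemLp (fun ω => c ω * (B t ω - B s ω)) 2 P :=
      memLp_mul_of_bounded hc hC ((hB.memLp t).sub (hB.memLp s))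
    have i1 : Integrable (fun ω => (c₁ ω * (B s₂ ω - B s₁ ω)) * (c₂ ω * (B t₂ ω - B s₂ ω))) P :=
      integrable_mul_of_memLp (hmem c₁ hm₁ C₁ hC₁ _ _) (hmem c₂ hm₂ C₂ hC₂ _ _)
    have i2 : Integrable (fun ω => (c₁ ω * (B t₁ ω - B s₂ ω)) * (c₂ ω * (B t₂ ω - B s₂ ω))) P :=
      integrable_mul_of_memLp (hmem c₁ hm₁ C₁ hC₁ _ _) (hmem c₂ hm₂ C₂ hC₂ _ _)
    rw [max_eq_right hsR, max_eq_right (by rw [sub_nonneg]; exact le_min ht' h₂')]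
    calc _ = ∫ ω, ((c₁ ω * (B s₂ ω - B s₁ ω)) * (c₂ ω * (B t₂ ω - B s₂ ω))
          + (c₁ ω * (B t₁ ω - B s₂ ω)) * (c₂ ω * (B t₂ ω - B s₂ ω))) ∂P :=
          integral_congr_ae (ae_of_all _ fun ω => by simp only []; ring)
      _ = 0 + (∫ ω, c₁ ω * c₂ ω ∂P) * (min (t₁ : ℝ) t₂ - s₂) := by
          rw [integral_add i1 i2]
          congr 1
          · rw [← e1]
            refine integral_congr_ae (ae_of_all _ fun ω => ?_)
            simp only [Pi.mul_apply, Pi.sub_apply]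
            ring
          · rw [show (∫ ω, c₁ ω * c₂ ω ∂P) = ∫ ω, (c₁ * c₂) ω ∂P from rfl, ← e2]
            refine integral_congr_ae (ae_of_all _ fun ω => ?_)
            simp only [Pi.mul_apply]
            ring
      _ = _ := zero_add _

lemma HasBrownianIncrements.integral_increment_mul (hB : HasBrownianIncrements 𝓕 P B)
    {s₁ t₁ s₂ t₂ : ℝ≥0} (h₁ : s₁ ≤ t₁) (h₂ : s₂ ≤ t₂) {c₁ c₂ : Ω → ℝ}
    (hc₁ : Measurable[𝓕 s₁] c₁) (hc₂ : Measurable[𝓕 s₂] c₂) {C₁ C₂ : ℝ}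
    (hC₁ : ∀ ω, |c₁ ω| ≤ C₁) (hC₂ : ∀ ω, |c₂ ω| ≤ C₂) :
    ∫ ω, (c₁ ω * (B t₁ ω - B s₁ ω)) * (c₂ ω * (B t₂ ω - B s₂ ω)) ∂P
      = (∫ ω, c₁ ω * c₂ ω ∂P) * max 0 (min (t₁ : ℝ) t₂ - max (s₁ : ℝ) s₂) := by
  rcases le_total s₁ s₂ with hs | hs
  · exact hB.integral_increment_mul_aux h₂ hs hc₁ hc₂ hC₁ hC₂
  · have h := hB.integral_increment_mul_aux (t₁ := t₂) h₁ hs hc₂ hc₁ hC₂ hC₁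
    simp only [mul_comm (c₁ _) (c₂ _), min_comm (t₁ : ℝ), max_comm (s₁ : ℝ)]
    rw [← h]
    exact integral_congr_ae (ae_of_all _ fun ω => mul_comm _ _)

lemma integral_indicator_mul_indicator {a b s₁ t₁ s₂ t₂ : ℝ≥0} (ha₁ : a ≤ s₁)
    (hb₁ : t₁ ≤ b) :
    ∫ r in Set.Ioc a b, (Set.Ioc s₁ t₁).indicator (fun _ => (1 : ℝ)) r *
        (Set.Ioc s₂ t₂).indicator (fun _ => (1 : ℝ)) r ∂timeMeasure
      = max 0 (min (t₁ : ℝ) t₂ - max (s₁ : ℝ) s₂) := by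
  have h : (fun r : ℝ≥0 => (Set.Ioc s₁ t₁).indicator (fun _ => (1 : ℝ)) r *
        (Set.Ioc s₂ t₂).indicator (fun _ => (1 : ℝ)) r)
      = (Set.Ioc (max s₁ s₂) (min t₁ t₂)).indicator 1 := by
    rw [← Set.Ioc_inter_Ioc]
    ext r
    rw [Set.inter_indicator_one]
    rfl
  rw [h, integral_indicator_one measurableSet_Ioc, measureReal_restrict_apply measurableSet_Ioc,
    Set.inter_eq_left.mpr (Set.Ioc_subset_Ioc (ha₁.trans (le_max_left _ _))
      ((min_le_left _ _).trans hb₁)), Measure.real, timeMeasure_Ioc, ENNReal.toReal_ofReal',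
    max_comm]
  push_cast
  rfl

namespace SimpleProcess

variable {a b a' b' : ℝ≥0}

lemma measurable_coeff' (φ : SimpleProcess 𝓕 a b) (i : Fin φ.n) : Measurable (φ.c i) :=
  (φ.measurable_coeff i).mono (𝓕.le _) le_rfl

lemma memLp_term (hB : HasBrownianIncrements 𝓕 P B) (φ : SimpleProcess 𝓕 a b) (i : Fin φ.n) :
    MemLp (fun ω => φ.c i ω * (B (φ.t i) ω - B (φ.s i) ω)) 2 P := by
  obtain ⟨C, hC⟩ := φ.bounded_coeff i
  exact memLp_mul_of_bounded (φ.measurable_coeff' i) hC ((hB.memLp _).sub (hB.memLp _))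

lemma memLp_integral (hB : HasBrownianIncrements 𝓕 P B) (φ : SimpleProcess 𝓕 a b) :
    MemLp (φ.integral B) 2 P :=
  memLp_finsetSum _ fun i _ => φ.memLp_term hB i

lemma memLp_eval_term [IsFiniteMeasure P] (φ : SimpleProcess 𝓕 a b) (c d : ℝ≥0) (i : Fin φ.n) :
    MemLp (fun z : ℝ≥0 × Ω => (Set.Ioc (φ.s i) (φ.t i)).indicator (fun _ => φ.c i z.2) z.1) 2
      ((timeMeasure.restrict (Set.Ioc c d)).prod P) := by
  obtain ⟨C, hC⟩ := φ.bounded_coeff i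
  refine MemLp.of_bound ?_ C (ae_of_all _ fun z => ?_)
  · refine Measurable.aestronglyMeasurable ?_
    exact ((φ.measurable_coeff' i).comp measurable_snd).indicator
      (measurable_fst measurableSet_Ioc : MeasurableSet (Prod.fst ⁻¹' Set.Ioc (φ.s i) (φ.t i)))
  · exact (norm_indicator_le_norm_self _ _).trans (hC _)

lemma memLp_eval [IsFiniteMeasure P] (φ : SimpleProcess 𝓕 a b) (c d : ℝ≥0) :
    MemLp (fun z : ℝ≥0 × Ω => φ.eval z.1 z.2) 2
      ((timeMeasure.restrict (Set.Ioc c d)).prod P) :=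
  memLp_finsetSum _ fun i _ => φ.memLp_eval_term c d i

/-- The Itô isometry for simple processes. -/
lemma integral_integral_sq [IsFiniteMeasure P] (hB : HasBrownianIncrements 𝓕 P B)
    (φ : SimpleProcess 𝓕 a b) :
    ∫ ω, φ.integral B ω ^ 2 ∂P
      = ∫ z : ℝ≥0 × Ω, φ.eval z.1 z.2 ^ 2 ∂((timeMeasure.restrict (Set.Ioc a b)).prod P) := by
  simp only [integral, eval, sq, Finset.sum_mul_sum]
  rw [integral_finsetSum _ fun i _ => integrable_finsetSum _ fun j _ =>
    integrable_mul_of_memLp (φ.memLp_term hB i) (φ.memLp_term hB j)]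
  rw [integral_finsetSum _ fun i _ => integrable_finsetSum _ fun j _ =>
    integrable_mul_of_memLp (φ.memLp_eval_term a b i) (φ.memLp_eval_term a b j)]
  refine Finset.sum_congr rfl fun i _ => ?_
  rw [integral_finsetSum _ fun j _ =>
    integrable_mul_of_memLp (φ.memLp_term hB i) (φ.memLp_term hB j)]
  rw [integral_finsetSum _ fun j _ =>
    integrable_mul_of_memLp (φ.memLp_eval_term a b i) (φ.memLp_eval_term a b j)]
  refine Finset.sum_congr rfl fun j _ => ?_
  obtain ⟨C₁, hC₁⟩ := φ.bounded_coeff i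
  obtain ⟨C₂, hC₂⟩ := φ.bounded_coeff j
  -- The intervals of a simple process may overlap, so off-diagonal pairs also contribute. Each pair
  -- gives the mean of `c i * c j` times the overlap length on both sides.
  rw [hB.integral_increment_mul (φ.le_mid i) (φ.le_mid j) (φ.measurable_coeff i)
    (φ.measurable_coeff j) hC₁ hC₂, ← integral_indicator_mul_indicator (φ.le_left i)
    (φ.le_right i), mul_comm, ← integral_prod_mul]
  refine integral_congr_ae (ae_of_all _ fun z => ?_)
  simp only [Set.indicator_apply]
  split_ifs <;> simp

lemma eLpNorm_integral [IsFiniteMeasure P] (hB : HasBrownianIncrements 𝓕 P B)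
    (φ : SimpleProcess 𝓕 a b) :
    eLpNorm (φ.integral B) 2 P
      = eLpNorm (fun z : ℝ≥0 × Ω => φ.eval z.1 z.2) 2
        ((timeMeasure.restrict (Set.Ioc a b)).prod P) := by
  rw [(φ.memLp_integral hB).eLpNorm_eq_integral_rpow_norm (by simp) (by simp),
    (φ.memLp_eval a b).eLpNorm_eq_integral_rpow_norm (by simp) (by simp)]
  have := φ.integral_integral_sq hB
  simpa using by rw [this]

/-- The simple process `x φ + y ψ`. -/
def lin (c d : ℝ≥0) (x y : ℝ) (φ : SimpleProcess 𝓕 a b) (ψ : SimpleProcess 𝓕 a' b')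
    (hca : c ≤ a) (hca' : c ≤ a') (hbd : b ≤ d) (hbd' : b' ≤ d) : SimpleProcess 𝓕 c d where
  n := φ.n + ψ.n
  s := Fin.addCases φ.s ψ.s
  t := Fin.addCases φ.t ψ.t
  c := Fin.addCases (fun i ω => x * φ.c i ω) (fun i ω => y * ψ.c i ω)
  le_left i := by
    induction i using Fin.addCases with
    | left i => simpa using hca.trans (φ.le_left i)
    | right i => simpa using hca'.trans (ψ.le_left i)
  le_mid i := by
    induction i using Fin.addCases with
    | left i => simpa using φ.le_mid i
    | right i => simpa using ψ.le_mid i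
  le_right i := by
    induction i using Fin.addCases with
    | left i => simpa using (φ.le_right i).trans hbd
    | right i => simpa using (ψ.le_right i).trans hbd'
  measurable_coeff i := by
    induction i using Fin.addCases with
    | left i =>
      rw [show Fin.addCases φ.s ψ.s (Fin.castAdd ψ.n i) = φ.s i from Fin.addCases_left i]
      simp only [Fin.addCases_left]
      exact (φ.measurable_coeff i).const_mul x
    | right i =>
      rw [show Fin.addCases φ.s ψ.s (Fin.natAdd φ.n i) = ψ.s i from Fin.addCases_right i]
      simp only [Fin.addCases_right]
      exact (ψ.measurable_coeff i).const_mul y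
  bounded_coeff i := by
    induction i using Fin.addCases with
    | left i =>
      obtain ⟨C, hC⟩ := φ.bounded_coeff i
      refine ⟨|x| * C, fun ω => ?_⟩
      simpa [abs_mul] using mul_le_mul_of_nonneg_left (hC ω) (abs_nonneg x)
    | right i =>
      obtain ⟨C, hC⟩ := ψ.bounded_coeff i
      refine ⟨|y| * C, fun ω => ?_⟩
      simpa [abs_mul] using mul_le_mul_of_nonneg_left (hC ω) (abs_nonneg y)

section lin

variable {c d : ℝ≥0} (x y : ℝ) (φ : SimpleProcess 𝓕 a b) (ψ : SimpleProcess 𝓕 a' b')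
    (hca : c ≤ a) (hca' : c ≤ a') (hbd : b ≤ d) (hbd' : b' ≤ d)

lemma lin_eval (r : ℝ≥0) (ω : Ω) :
    (lin c d x y φ ψ hca hca' hbd hbd').eval r ω = x * φ.eval r ω + y * ψ.eval r ω := by
  refine (Fin.sum_univ_add _).trans ?_
  simp [eval, lin, Finset.mul_sum, Set.indicator_apply]

lemma lin_integral (B : ℝ≥0 → Ω → ℝ) (ω : Ω) :
    (lin c d x y φ ψ hca hca' hbd hbd').integral B ω
      = x * φ.integral B ω + y * ψ.integral B ω := by
  refine (Fin.sum_univ_add _).trans ?_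
  simp [integral, lin, Finset.mul_sum, mul_assoc]

end lin

/-- The restriction of a simple process to the times before `T`. -/
def before (φ : SimpleProcess 𝓕 a b) (T : ℝ≥0) (hT : a ≤ T) : SimpleProcess 𝓕 a T where
  n := φ.n
  s i := min (φ.s i) T
  t i := min (φ.t i) T
  -- If `φ.s i` exceeds `T`, the truncated interval is empty, but `φ.c i` need not be `𝓕
  -- T`-measurable, so it is replaced by zero.
  c i := if φ.s i ≤ T then φ.c i else fun _ => 0
  le_left i := le_min (φ.le_left i) hT
  le_mid i := min_le_min_right _ (φ.le_mid i)
  le_right _ := min_le_right _ _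
  measurable_coeff i := by
    split_ifs with h
    · rw [min_eq_left h]; exact φ.measurable_coeff i
    · exact measurable_const
  bounded_coeff i := by
    split_ifs with h
    · exact φ.bounded_coeff i
    · exact ⟨0, by simp⟩

/-- The restriction of a simple process to the times after `T`. -/
def after (φ : SimpleProcess 𝓕 a b) (T : ℝ≥0) (hT : T ≤ b) : SimpleProcess 𝓕 T b where
  n := φ.n
  s i := max (φ.s i) T
  t i := max (φ.t i) T
  c := φ.c
  le_left _ := le_max_right _ _
  le_mid i := max_le_max_right _ (φ.le_mid i)
  le_right i := max_le (φ.le_right i) hT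
  measurable_coeff i := (φ.measurable_coeff i).mono (𝓕.mono (le_max_left _ _)) le_rfl
  bounded_coeff := φ.bounded_coeff

lemma before_eval (φ : SimpleProcess 𝓕 a b) {T : ℝ≥0} (hT : a ≤ T) {r : ℝ≥0} (hr : r ≤ T)
    (ω : Ω) : (φ.before T hT).eval r ω = φ.eval r ω := by
  refine Finset.sum_congr rfl fun i _ => ?_
  simp only [before, Set.indicator_apply, Set.mem_Ioc, min_lt_iff, le_min_iff, hr, and_true,
    not_lt.mpr hr, or_false]
  by_cases h : φ.s i ≤ T
  · simp [h]
  · have : ¬ φ.s i < r := fun h' => h (h'.le.trans hr)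
    simp [this]

lemma before_add_after_integral (φ : SimpleProcess 𝓕 a b) {T : ℝ≥0} (hT : a ≤ T) (hT' : T ≤ b)
    (B : ℝ≥0 → Ω → ℝ) (ω : Ω) :
    (φ.before T hT).integral B ω + (φ.after T hT').integral B ω = φ.integral B ω := by
  unfold integral
  change (∑ i : Fin φ.n, _) + (∑ i : Fin φ.n, _) = ∑ i : Fin φ.n, _
  rw [← Finset.sum_add_distrib]
  refine Finset.sum_congr rfl fun i _ => ?_
  simp only [before, after]
  have hm := φ.le_mid i
  rcases le_total (φ.s i) T with h | h
  · rcases le_total (φ.t i) T with h' | h'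
    · simp [h, h']
    · simp [h, h']; ring
  · rcases h.eq_or_lt with h0 | h0
    · have : T ≤ φ.t i := h.trans hm
      simp [this, ← h0]
    · have : T ≤ φ.t i := h.trans hm
      simp [h, this]

lemma measurable_integral (hB : HasBrownianIncrements 𝓕 P B) (φ : SimpleProcess 𝓕 a b) :
    Measurable[𝓕 b] (φ.integral B) := by
  refine Finset.measurable_sum _ fun i _ => ?_
  have hs := (φ.le_mid i).trans (φ.le_right i)
  exact ((φ.measurable_coeff i).mono (𝓕.mono hs) le_rfl).mul
    (((hB.adapted _).mono (𝓕.mono (φ.le_right i)) le_rfl).sub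
      ((hB.adapted _).mono (𝓕.mono hs) le_rfl))

/-- The integral of a simple process over `(a, b]` is orthogonal to the past of `a`. -/
lemma setIntegral_integral_eq_zero [IsFiniteMeasure P] (hB : HasBrownianIncrements 𝓕 P B)
    (φ : SimpleProcess 𝓕 a b) {A : Set Ω} (hA : MeasurableSet[𝓕 a] A) :
    ∫ ω in A, φ.integral B ω ∂P = 0 := by
  unfold integral
  rw [integral_finsetSum _ fun i _ =>
    ((φ.memLp_term hB i).integrable one_le_two).integrableOn]
  refine Finset.sum_eq_zero fun i _ => ?_
  rw [← integral_indicator (𝓕.le _ _ hA)]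
  have hA' : MeasurableSet[𝓕 (φ.s i)] A := 𝓕.mono (φ.le_left i) _ hA
  rw [← hB.integral_mul_sub (φ.le_mid i) ((φ.measurable_coeff i).indicator hA')]
  refine integral_congr_ae (ae_of_all _ fun ω => ?_)
  by_cases hω : ω ∈ A <;> simp [hω]

end SimpleProcess

end Isometry

/-! ### L² limits: measurability, integrals and Gaussian laws. -/

section LpLimits

variable {α : Type*} {mα : MeasurableSpace α} {μ : Measure α}

lemma integral_sq_eq_eLpNorm_sq {f : α → ℝ} (hf : MemLp f 2 μ) :
    ∫ x, f x ^ 2 ∂μ = (eLpNorm f 2 μ).toReal ^ 2 := by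
  have h0 : 0 ≤ ∫ x, f x ^ 2 ∂μ := integral_nonneg fun x => sq_nonneg _
  rw [hf.eLpNorm_eq_integral_rpow_norm (by simp) (by simp)]
  simp only [ENNReal.toReal_ofNat, Real.rpow_ofNat, Real.norm_eq_abs, sq_abs]
  rw [ENNReal.toReal_ofReal (by positivity), ← Real.rpow_natCast, ← Real.rpow_mul h0]
  simp

lemma tendsto_integral_sq {f : ℕ → α → ℝ} {g : α → ℝ} (hf : ∀ n, MemLp (f n) 2 μ)
    (hg : MemLp g 2 μ)
    (h : Filter.Tendsto (fun n => eLpNorm (fun x => f n x - g x) 2 μ) Filter.atTop (𝓝 0)) :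
    Filter.Tendsto (fun n => ∫ x, f n x ^ 2 ∂μ) Filter.atTop (𝓝 (∫ x, g x ^ 2 ∂μ)) := by
  have h1 := (Lp.tendsto_Lp_iff_tendsto_eLpNorm'' f hf g hg).mpr h
  have h2 := (h1.norm).pow 2
  simp only [Lp.norm_toLp] at h2
  simpa only [integral_sq_eq_eLpNorm_sq (hf _), integral_sq_eq_eLpNorm_sq hg] using h2

lemma exists_subseq_ae_tendsto {f : ℕ → α → ℝ} {g : α → ℝ} (hf : ∀ n, MemLp (f n) 2 μ)
    (hg : MemLp g 2 μ)
    (h : Filter.Tendsto (fun n => eLpNorm (fun x => f n x - g x) 2 μ) Filter.atTop (𝓝 0)) :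
    ∃ ns : ℕ → ℕ, StrictMono ns ∧
      ∀ᵐ x ∂μ, Filter.Tendsto (fun i => f (ns i) x) Filter.atTop (𝓝 (g x)) :=
  (tendstoInMeasure_of_tendsto_eLpNorm (p := 2) (by simp) (fun n => (hf n).aestronglyMeasurable)
    hg.aestronglyMeasurable h).exists_seq_tendsto_ae

/-- An `L²` limit of functions measurable for a sub-σ-algebra is a.e. measurable for it. -/
lemma aestronglyMeasurable_of_tendsto_eLpNorm {m : MeasurableSpace α}
    {f : ℕ → α → ℝ} {g : α → ℝ} (hf : ∀ n, MemLp (f n) 2 μ) (hg : MemLp g 2 μ)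
    (hfm : ∀ n, Measurable[m] (f n))
    (h : Filter.Tendsto (fun n => eLpNorm (fun x => f n x - g x) 2 μ) Filter.atTop (𝓝 0)) :
    AEStronglyMeasurable[m] g μ := by
  obtain ⟨ns, -, hns⟩ := exists_subseq_ae_tendsto hf hg h
  -- The `limsup` is `m`-measurable everywhere, including where the subsequence diverges; no
  -- completeness of `m` is needed.
  refine ⟨fun x => Filter.limsup (fun i => f (ns i) x) Filter.atTop, ?_, ?_⟩
  · exact (Measurable.limsup fun i => hfm (ns i)).stronglyMeasurable
  · filter_upwards [hns] with x hx using hx.limsup_eq.symm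

lemma tendsto_setIntegral_of_tendsto_eLpNorm [IsFiniteMeasure μ]
    {f : ℕ → α → ℝ} {g : α → ℝ} (hf : ∀ n, MemLp (f n) 2 μ) (hg : MemLp g 2 μ)
    (h : Filter.Tendsto (fun n => eLpNorm (fun x => f n x - g x) 2 μ) Filter.atTop (𝓝 0))
    (A : Set α) :
    Filter.Tendsto (fun n => ∫ x in A, f n x ∂μ) Filter.atTop (𝓝 (∫ x in A, g x ∂μ)) := by
  refine tendsto_setIntegral_of_L1' g hg.aestronglyMeasurable
    (Filter.Eventually.of_forall fun n => (hf n).integrable one_le_two) ?_ A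
  have hC : μ Set.univ ^ (1 / (1 : ℝ≥0∞).toReal - 1 / (2 : ℝ≥0∞).toReal) ≠ ∞ :=
    ENNReal.rpow_ne_top_of_nonneg (by norm_num) (measure_ne_top _ _)
  have h' := ENNReal.Tendsto.mul_const h (Or.inr hC)
  rw [zero_mul] at h'
  refine tendsto_of_tendsto_of_tendsto_of_le_of_le tendsto_const_nhds h' (fun _ => zero_le)
    fun n => ?_
  exact eLpNorm_le_eLpNorm_mul_rpow_measure_univ one_le_two
    ((hf n).sub hg).aestronglyMeasurable

/-- An `L²` limit of centered Gaussian variables is Gaussian. -/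
lemma hasLaw_gaussianReal_of_tendsto_eLpNorm {P : Measure α} [IsProbabilityMeasure P]
    {f : ℕ → α → ℝ} {g : α → ℝ} (hf : ∀ n, HasGaussianLaw (f n) P)
    (hf0 : ∀ n, ∫ x, f n x ∂P = 0) (hg : MemLp g 2 P)
    (h : Filter.Tendsto (fun n => eLpNorm (fun x => f n x - g x) 2 P) Filter.atTop (𝓝 0)) :
    HasLaw g (gaussianReal 0 (∫ x, g x ^ 2 ∂P).toNNReal) P := by
  have hf2 : ∀ n, MemLp (f n) 2 P := fun n => (hf n).memLp_two
  refine ⟨hg.aestronglyMeasurable.aemeasurable, ?_⟩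
  have : IsProbabilityMeasure (P.map g) :=
    Measure.isProbabilityMeasure_map hg.aestronglyMeasurable.aemeasurable
  -- The characteristic functions have two limits to compare: one by dominated convergence along an
  -- a.e. convergent subsequence, one from the explicit Gaussian formula and convergence of second
  -- moments. Variance zero needs no separate case.
  refine Measure.ext_of_charFun (funext fun t => ?_)
  have hchar (k : α → ℝ) (hk : AEMeasurable k P) :
      charFun (P.map k) t = ∫ x, Complex.exp (t * k x * Complex.I) ∂P := by
    rw [charFun_apply_real, integral_map hk (by fun_prop)]
  obtain ⟨ns, hns, hlim⟩ := exists_subseq_ae_tendsto hf2 hg h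
  have h1 : Filter.Tendsto (fun i => charFun (P.map (f (ns i))) t) Filter.atTop
      (𝓝 (charFun (P.map g) t)) := by
    rw [hchar g hg.aestronglyMeasurable.aemeasurable]
    simp only [fun i => hchar (f (ns i)) (hf (ns i)).aemeasurable]
    refine tendsto_integral_of_dominated_convergence (fun _ => 1) (fun i => ?_)
      (integrable_const _) (fun i => ae_of_all _ fun x => ?_) ?_
    · have := (hf (ns i)).aemeasurable
      exact AEMeasurable.aestronglyMeasurable (by fun_prop)
    · rw [← Complex.ofReal_mul, Complex.norm_exp_ofReal_mul_I]
    · filter_upwards [hlim] with x hx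
      have hc : Continuous fun y : ℝ => Complex.exp (t * y * Complex.I) := by fun_prop
      exact (hc.tendsto _).comp hx
  have h2 : Filter.Tendsto (fun i => charFun (P.map (f (ns i))) t) Filter.atTop
      (𝓝 (charFun (gaussianReal 0 (∫ x, g x ^ 2 ∂P).toNNReal) t)) := by
    have hv := (tendsto_integral_sq hf2 hg h).comp hns.tendsto_atTop
    have e (i : ℕ) : charFun (P.map (f (ns i))) t
        = Complex.exp (-((∫ x, f (ns i) x ^ 2 ∂P : ℝ) * t ^ 2 / 2)) := by
      rw [(hf (ns i)).map_eq_gaussianReal, charFun_gaussianReal, hf0,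
        variance_of_integral_eq_zero (hf _).aemeasurable (hf0 _),
        Real.coe_toNNReal _ (integral_nonneg fun x => sq_nonneg _)]
      simp
    rw [charFun_gaussianReal, Real.coe_toNNReal _ (integral_nonneg fun x => sq_nonneg _)]
    simp only [e]
    have hc : Continuous fun y : ℝ => Complex.exp (-((y : ℂ) * t ^ 2 / 2)) := by fun_prop
    simpa [Function.comp_def] using (hc.tendsto _).comp hv
  exact tendsto_nhds_unique h1 h2

end LpLimits

/-! ### Increments of linear combinations of the Brownian pair. -/

section Brownian

variable {𝓕 : Filtration ℝ≥0 mΩ} {P : Measure Ω} [IsProbabilityMeasure P] {W W' : ℝ≥0 → Ω → ℝ}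

lemma memLp_brownian {P : Measure Ω} {B : ℝ≥0 → Ω → ℝ} (hB : IsBrownianReal B P) (t : ℝ≥0) :
    MemLp (B t) 2 P :=
  (hB.isGaussianProcess.hasGaussianLaw_eval t).memLp_two

lemma integral_mul_brownian {B : ℝ≥0 → Ω → ℝ} (hB : IsBrownianReal B P) (s t : ℝ≥0) :
    ∫ ω, B s ω * B t ω ∂P = min (s : ℝ) t := by
  have h := hB.covariance_eval s t
  rw [covariance_eq_sub (memLp_brownian hB s)
    (memLp_brownian hB t), hB.integral_eval s, zero_mul, sub_zero] at h
  simpa using h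

/-- The σ-algebra generated by the increments of `(W, W')` after time `s`. -/
abbrev futureIncrements (W W' : ℝ≥0 → Ω → ℝ) (s : ℝ≥0) : MeasurableSpace Ω :=
  MeasurableSpace.comap
    (fun ω (t : ℝ≥0) => (W (s + t) ω - W s ω, W' (s + t) ω - W' s ω)) inferInstance

lemma measurable_futureIncrements_left (W W' : ℝ≥0 → Ω → ℝ) {s t : ℝ≥0} (hst : s ≤ t) :
    Measurable[futureIncrements W W' s] (fun ω => W t ω - W s ω) := by
  have h : Measurable fun p : ℝ≥0 → ℝ × ℝ => (p (t - s)).1 := by fun_prop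
  have h2 := h.comp (comap_measurable
    (fun ω (t : ℝ≥0) => (W (s + t) ω - W s ω, W' (s + t) ω - W' s ω)))
  simpa only [Function.comp_def, add_tsub_cancel_of_le hst] using h2

lemma measurable_futureIncrements_right (W W' : ℝ≥0 → Ω → ℝ) {s t : ℝ≥0} (hst : s ≤ t) :
    Measurable[futureIncrements W W' s] (fun ω => W' t ω - W' s ω) := by
  have h : Measurable fun p : ℝ≥0 → ℝ × ℝ => (p (t - s)).2 := by fun_prop
  have h2 := h.comp (comap_measurable
    (fun ω (t : ℝ≥0) => (W (s + t) ω - W s ω, W' (s + t) ω - W' s ω)))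
  simpa only [Function.comp_def, add_tsub_cancel_of_le hst] using h2

lemma IsBrownianPair.futureIncrements_le {P : Measure Ω} (hW : IsBrownianPair 𝓕 P W W') (s : ℝ≥0) :
    futureIncrements W W' s ≤ mΩ := by
  refine Measurable.comap_le (measurable_pi_lambda _ fun t => ?_)
  have hL (t : ℝ≥0) : Measurable (W t) := (hW.adapted_left t).mono (𝓕.le t) le_rfl
  have hR (t : ℝ≥0) : Measurable (W' t) := (hW.adapted_right t).mono (𝓕.le t) le_rfl
  exact ((hL _).sub (hL _)).prodMk ((hR _).sub (hR _))

lemma integral_mul_linear_combination (hW : IsBrownianPair 𝓕 P W W') (x y : ℝ)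
    (hxy : x ^ 2 + y ^ 2 = 1) (s t : ℝ≥0) :
    ∫ ω, (x * W s ω + y * W' s ω) * (x * W t ω + y * W' t ω) ∂P = min (s : ℝ) t := by
  have hL := memLp_brownian hW.brownian_left
  have hR := memLp_brownian hW.brownian_right
  have cross (s t : ℝ≥0) : ∫ ω, W s ω * W' t ω ∂P = 0 := by
    have h := (hW.indep.comp (measurable_pi_apply s) (measurable_pi_apply t)
      ).integral_fun_mul_eq_mul_integral (hL s).aestronglyMeasurable (hR t).aestronglyMeasurable
    refine h.trans ?_
    rw [show (∫ ω, ((fun p : ℝ≥0 → ℝ => p s) ∘ fun ω t => W t ω) ω ∂P) = ∫ ω, W s ω ∂P from rfl,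
      hW.brownian_left.integral_eval, zero_mul]
  have i1 := integrable_mul_of_memLp (hL s) (hL t)
  have i2 := integrable_mul_of_memLp (hL s) (hR t)
  have i3 := integrable_mul_of_memLp (hL t) (hR s)
  have i4 := integrable_mul_of_memLp (hR s) (hR t)
  calc _ = ∫ ω, ((x ^ 2 * (W s ω * W t ω) + y ^ 2 * (W' s ω * W' t ω))
        + (x * y * (W s ω * W' t ω) + x * y * (W t ω * W' s ω))) ∂P :=
        integral_congr_ae (ae_of_all _ fun ω => by simp only []; ring)
    _ = (x ^ 2 * min (s : ℝ) t + y ^ 2 * min (s : ℝ) t) + (x * y * 0 + x * y * 0) := by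
        have j1 : Integrable
            (fun ω => x ^ 2 * (W s ω * W t ω) + y ^ 2 * (W' s ω * W' t ω)) P :=
          (i1.const_mul _).add (i4.const_mul _)
        have j2 : Integrable
            (fun ω => x * y * (W s ω * W' t ω) + x * y * (W t ω * W' s ω)) P :=
          (i2.const_mul _).add (i3.const_mul _)
        rw [integral_add j1 j2, integral_add (i1.const_mul _) (i4.const_mul _),
          integral_add (i2.const_mul _) (i3.const_mul _)]
        simp only [integral_const_mul, integral_mul_brownian hW.brownian_left,
          integral_mul_brownian hW.brownian_right, cross]
    _ = min (s : ℝ) t := by rw [← add_mul, hxy]; ring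

/-- The unit vectors `(1, 0)` and `(ρ, √(1 - ρ²))` give `W` and the stock's driver, so a single Itô
theory serves both. -/
lemma IsBrownianPair.hasBrownianIncrements_linear_combination (hW : IsBrownianPair 𝓕 P W W')
    (x y : ℝ) (hxy : x ^ 2 + y ^ 2 = 1) :
    HasBrownianIncrements 𝓕 P (fun t ω => x * W t ω + y * W' t ω) := by
  have hL := memLp_brownian hW.brownian_left
  have hR := memLp_brownian hW.brownian_right
  have hmem (t : ℝ≥0) : MemLp (fun ω => x * W t ω + y * W' t ω) 2 P :=
    ((hL t).const_mul x).add ((hR t).const_mul y)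
  have h0 (t : ℝ≥0) : ∫ ω, (x * W t ω + y * W' t ω) ∂P = 0 := by
    rw [integral_add (((hL t).const_mul x).integrable one_le_two)
      (((hR t).const_mul y).integrable one_le_two), integral_const_mul, integral_const_mul,
      hW.brownian_left.integral_eval, hW.brownian_right.integral_eval]
    simp
  refine ⟨fun t => ?_, hmem, fun s t _ => ?_, fun s t u hst hsu => ?_, fun s t u hst hsu => ?_⟩
  · exact ((hW.adapted_left t).const_mul x).add ((hW.adapted_right t).const_mul y)
  · rw [integral_sub ((hmem t).integrable one_le_two) ((hmem s).integrable one_le_two), h0, h0,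
      sub_zero]
  · have hst' : (s : ℝ) ≤ t := hst
    have hsu' : (s : ℝ) ≤ u := hsu
    have i (p q : ℝ≥0) := integrable_mul_of_memLp (hmem p) (hmem q)
    have hc := integral_mul_linear_combination hW x y hxy
    have j (v : ℝ≥0) : Integrable (fun ω => (x * W t ω + y * W' t ω) * (x * W v ω + y * W' v ω)
        - (x * W s ω + y * W' s ω) * (x * W v ω + y * W' v ω)) P := (i t v).sub (i s v)
    have e (ω : Ω) : (x * W t ω + y * W' t ω - (x * W s ω + y * W' s ω))
          * (x * W u ω + y * W' u ω - (x * W s ω + y * W' s ω))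
        = ((x * W t ω + y * W' t ω) * (x * W u ω + y * W' u ω)
            - (x * W s ω + y * W' s ω) * (x * W u ω + y * W' u ω))
          - ((x * W t ω + y * W' t ω) * (x * W s ω + y * W' s ω)
            - (x * W s ω + y * W' s ω) * (x * W s ω + y * W' s ω)) := by ring
    simp only [e]
    rw [integral_sub (j u) (j s), integral_sub (i t u) (i s u),
      integral_sub (i t s) (i s s), hc, hc, hc, hc, min_eq_left hsu', min_eq_right hst', min_self]
    ring
  · refine indep_of_indep_of_le_left (hW.indep_increments s) ?_
    have e (t : ℝ≥0) (hst : s ≤ t) : Measurable[futureIncrements W W' s]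
        (fun ω => x * W t ω + y * W' t ω - (x * W s ω + y * W' s ω)) := by
      have := ((measurable_futureIncrements_left W W' hst).const_mul x).add
        ((measurable_futureIncrements_right W W' hst).const_mul y)
      convert this using 2
      simp only [Pi.add_apply]
      ring
    exact ((e t hst).prodMk (e u hsu)).comap_le

lemma IsBrownianPair.hasBrownianIncrements_left (hW : IsBrownianPair 𝓕 P W W') :
    HasBrownianIncrements 𝓕 P W := by
  simpa using hW.hasBrownianIncrements_linear_combination 1 0 (by norm_num)

lemma IsBrownianPair.hasBrownianIncrements_mixedBM (hW : IsBrownianPair 𝓕 P W W') (θ : Params) :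
    HasBrownianIncrements 𝓕 P (θ.mixedBM W W') := by
  refine hW.hasBrownianIncrements_linear_combination θ.ρ (Real.sqrt (1 - θ.ρ ^ 2)) ?_
  have h := θ.ρ_mem
  rw [Real.sq_sqrt (by nlinarith [h.1, h.2])]
  ring

end Brownian

/-! ### Uniqueness of the Itô integral and step approximation of deterministic integrands. -/

section Ito

variable {𝓕 : Filtration ℝ≥0 mΩ} {P : Measure Ω} [IsProbabilityMeasure P] {B : ℝ≥0 → Ω → ℝ}
  {a b : ℝ≥0} {f : ℝ≥0 → Ω → ℝ} {Y : Ω → ℝ}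

/-- The elementary integrals of any approximating sequence converge to the Itô integral. -/
lemma IsItoIntegral.tendsto (hB : HasBrownianIncrements 𝓕 P B)
    (h : IsItoIntegral 𝓕 P B a b f Y) (φ : ℕ → SimpleProcess 𝓕 a b)
    (hφ : Filter.Tendsto
      (fun n => eLpNorm (fun z : ℝ≥0 × Ω => (φ n).eval z.1 z.2 - f z.1 z.2) 2
        ((timeMeasure.restrict (Set.Ioc a b)).prod P)) Filter.atTop (𝓝 0)) :
    Filter.Tendsto (fun n => eLpNorm (fun ω => (φ n).integral B ω - Y ω) 2 P)
      Filter.atTop (𝓝 0) := by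
  obtain ⟨hf, hY, ψ, hψ, hψY⟩ := h
  have hsum := (hφ.add hψ).add hψY
  simp only [add_zero] at hsum
  refine tendsto_of_tendsto_of_tendsto_of_le_of_le tendsto_const_nhds hsum (fun _ => zero_le)
    fun n => ?_
  -- `χ` is the difference of the two approximants; the isometry bounds its integral by the sum of
  -- their distances to `f`.
  set χ := SimpleProcess.lin a b 1 (-1) (φ n) (ψ n) le_rfl le_rfl le_rfl le_rfl
  have e1 : (fun ω => (φ n).integral B ω - Y ω)
      = χ.integral B + fun ω => (ψ n).integral B ω - Y ω := by
    ext ω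
    simp only [χ, Pi.add_apply, SimpleProcess.lin_integral]
    ring
  have e2 : (fun z : ℝ≥0 × Ω => χ.eval z.1 z.2)
      = (fun z : ℝ≥0 × Ω => (φ n).eval z.1 z.2 - f z.1 z.2)
        - fun z : ℝ≥0 × Ω => (ψ n).eval z.1 z.2 - f z.1 z.2 := by
    ext z
    simp only [χ, Pi.sub_apply, SimpleProcess.lin_eval]
    ring
  change eLpNorm (fun ω => (φ n).integral B ω - Y ω) 2 P ≤ _
  rw [e1]
  refine (eLpNorm_add_le (χ.memLp_integral hB).aestronglyMeasurable
    (((ψ n).memLp_integral hB).sub hY).aestronglyMeasurable one_le_two).trans ?_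
  refine add_le_add ?_ le_rfl
  rw [χ.eLpNorm_integral hB, e2]
  exact eLpNorm_sub_le (((φ n).memLp_eval a b).sub hf).aestronglyMeasurable
    (((ψ n).memLp_eval a b).sub hf).aestronglyMeasurable one_le_two

/-- The `k`-th of `n + 1` equidistant points from `a` to `b`. -/
def gridPoint (a b : ℝ≥0) (n k : ℕ) : ℝ≥0 := a + (b - a) * (k / (n + 1))

lemma gridPoint_mono (a b : ℝ≥0) (n : ℕ) : Monotone (gridPoint a b n) := by
  intro k l hkl
  unfold gridPoint
  gcongr

lemma gridPoint_zero (a b : ℝ≥0) (n : ℕ) : gridPoint a b n 0 = a := by simp [gridPoint]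

lemma gridPoint_last {a b : ℝ≥0} (hab : a ≤ b) (n : ℕ) : gridPoint a b n (n + 1) = b := by
  simp [gridPoint, add_tsub_cancel_of_le hab]

lemma gridPoint_succ (a b : ℝ≥0) (n k : ℕ) :
    gridPoint a b n (k + 1) = gridPoint a b n k + (b - a) / (n + 1) := by
  simp only [gridPoint]
  push_cast
  ring

/-- The left-point step approximation of a deterministic integrand. -/
def stepProcess (𝓕 : Filtration ℝ≥0 mΩ) (f : ℝ≥0 → ℝ) {a b : ℝ≥0} (hab : a ≤ b) (n : ℕ) :
    SimpleProcess 𝓕 a b where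
  -- With `n + 1` cells the mesh `(b - a) / (n + 1)` makes sense for `n = 0` too.
  n := n + 1
  s i := gridPoint a b n i
  t i := gridPoint a b n (i + 1)
  c i _ := f (gridPoint a b n i)
  le_left _ := (gridPoint_zero a b n).ge.trans (gridPoint_mono a b n (Nat.zero_le _))
  le_mid _ := gridPoint_mono a b n (Nat.le_succ _)
  le_right i := (gridPoint_mono a b n (Nat.succ_le_of_lt i.2)).trans (gridPoint_last hab n).le
  measurable_coeff _ := measurable_const
  bounded_coeff i := ⟨|f (gridPoint a b n i)|, fun _ => le_rfl⟩

/-- Exactly one cell contains `r`, and `q` is its left endpoint. The mesh bound lets uniform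
continuity of `f` yield uniform convergence. -/
lemma exists_stepProcess_eval_eq (f : ℝ≥0 → ℝ) (hab : a ≤ b) (n : ℕ) {r : ℝ≥0}
    (hr : r ∈ Set.Ioc a b) :
    ∃ q ∈ Set.Icc a b, dist q r ≤ (b - a) / (n + 1) ∧
      ∀ ω : Ω, (stepProcess 𝓕 f hab n).eval r ω = f q := by
  have hcover := (gridPoint_mono a b n).biUnion_Ico_Ioc_map_succ 0 (n + 1)
  rw [gridPoint_zero, gridPoint_last hab] at hcover
  rw [← hcover] at hr
  obtain ⟨k, hk, hkr⟩ := Set.mem_iUnion₂.mp hr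
  have hk' : k < n + 1 := hk.2
  simp only [Nat.succ_eq_succ] at hkr
  refine ⟨gridPoint a b n k, ⟨(gridPoint_zero a b n).ge.trans (gridPoint_mono a b n k.zero_le),
    (gridPoint_mono a b n hk'.le).trans (gridPoint_last hab n).le⟩, ?_, fun ω => ?_⟩
  · have h1 : (gridPoint a b n k : ℝ) ≤ r := by exact_mod_cast hkr.1.le
    have h2 : (r : ℝ) ≤ gridPoint a b n k + (b - a) / (n + 1) := by
      have h := hkr.2
      rw [Nat.succ_eq_add_one, gridPoint_succ] at h
      have h' : (r : ℝ) ≤ ((gridPoint a b n k + (b - a) / (n + 1) : ℝ≥0) : ℝ) := h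
      push_cast [NNReal.coe_sub hab] at h'
      exact h'
    rw [NNReal.dist_eq, abs_sub_comm, abs_of_nonneg (by linarith)]
    linarith
  · unfold SimpleProcess.eval
    change ∑ i : Fin (n + 1), (Set.Ioc (gridPoint a b n i) (gridPoint a b n (i + 1))).indicator
      (fun _ => f (gridPoint a b n i)) r = _
    rw [Finset.sum_eq_single (⟨k, hk'⟩ : Fin (n + 1))]
    · exact Set.indicator_of_mem hkr _
    · intro i _ hi
      refine Set.indicator_of_notMem (fun hir => ?_) _
      have hne : (i : ℕ) ≠ k := fun h => hi (Fin.ext h)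
      exact Set.disjoint_left.mp ((gridPoint_mono a b n).pairwise_disjoint_on_Ioc_succ hne) hir hkr
    · simp

lemma ae_fst_mem_Ioc {P : Measure Ω} (a b : ℝ≥0) :
    ∀ᵐ z : ℝ≥0 × Ω ∂((timeMeasure.restrict (Set.Ioc a b)).prod P), z.1 ∈ Set.Ioc a b :=
  Measure.quasiMeasurePreserving_fst.ae (ae_restrict_mem measurableSet_Ioc)

/-- Uniform convergence to zero on `(a, b]` implies convergence to zero in `L²((a, b] × Ω)`. -/
lemma tendsto_eLpNorm_of_uniform {g : ℕ → ℝ≥0 → Ω → ℝ}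
    (hg : ∀ δ > 0, ∀ᶠ n in Filter.atTop, ∀ r ∈ Set.Ioc a b, ∀ ω, |g n r ω| ≤ δ) :
    Filter.Tendsto (fun n => eLpNorm (fun z : ℝ≥0 × Ω => g n z.1 z.2) 2
      ((timeMeasure.restrict (Set.Ioc a b)).prod P)) Filter.atTop (𝓝 0) := by
  set μ := (timeMeasure.restrict (Set.Ioc a b)).prod P
  rw [ENNReal.tendsto_nhds_zero]
  intro ε hε
  have hC : μ Set.univ ^ (2 : ℝ≥0∞).toReal⁻¹ ≠ ∞ :=
    ENNReal.rpow_ne_top_of_nonneg (by norm_num) (measure_ne_top _ _)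
  have hlim : Filter.Tendsto
      (fun δ : ℝ => μ Set.univ ^ (2 : ℝ≥0∞).toReal⁻¹ * ENNReal.ofReal δ) (𝓝[>] 0) (𝓝 0) := by
    have h1 := (ENNReal.continuous_ofReal.tendsto 0).mono_left (nhdsWithin_le_nhds (s := Set.Ioi 0))
    simpa using ENNReal.Tendsto.const_mul h1 (Or.inr hC)
  obtain ⟨δ, hδε, hδ⟩ := ((hlim.eventually_le_const hε).and self_mem_nhdsWithin).exists
  filter_upwards [hg δ hδ] with n hn
  refine (eLpNorm_le_of_ae_bound ?_).trans hδε
  filter_upwards [ae_fst_mem_Ioc a b] with z hz using hn z.1 hz z.2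

lemma stepProcess_uniform {f : ℝ≥0 → ℝ} (hf : Continuous f) (hab : a ≤ b) {δ : ℝ} (hδ : 0 < δ) :
    ∀ᶠ n in Filter.atTop, ∀ r ∈ Set.Ioc a b, ∀ ω : Ω,
      |(stepProcess 𝓕 f hab n).eval r ω - f r| ≤ δ := by
  have huc := isCompact_Icc.uniformContinuousOn_of_continuous (hf.continuousOn (s := Set.Icc a b))
  rw [Metric.uniformContinuousOn_iff] at huc
  obtain ⟨η, hη, h⟩ := huc δ hδ
  have hlim : Filter.Tendsto (fun n : ℕ => ((b : ℝ) - a) / (n + 1)) Filter.atTop (𝓝 0) :=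
    tendsto_const_div_atTop_nhds_zero_nat ((b : ℝ) - a) |>.comp (Filter.tendsto_add_atTop_nat 1)
      |>.congr fun n => by simp
  filter_upwards [hlim.eventually_lt_const hη] with n hn r hr ω
  obtain ⟨q, hq, hqd, hqe⟩ := exists_stepProcess_eval_eq (Ω := Ω) (𝓕 := 𝓕) f hab n hr
  rw [hqe, ← Real.dist_eq]
  exact (h q hq r (Set.Ioc_subset_Icc_self hr) (hqd.trans_lt hn)).le

lemma SimpleProcess.eval_of_notMem (φ : SimpleProcess 𝓕 a b) {r : ℝ≥0} (hr : r ∉ Set.Ioc a b)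
    (ω : Ω) : φ.eval r ω = 0 :=
  Finset.sum_eq_zero fun i _ => Set.indicator_of_notMem
    (fun h => hr (Set.Ioc_subset_Ioc (φ.le_left i) (φ.le_right i) h)) _

end Ito

/-! ### Moments of centred Gaussian laws. -/

section Gaussian

/-- Scaling the standard law covers `v = 0`, where no density exists; the case `T = 0` thus needs no
separate treatment in the pricing formula. -/
lemma gaussianReal_eq_map_standard {v : ℝ} (hv : 0 ≤ v) :
    gaussianReal 0 v.toNNReal = (gaussianReal 0 1).map (fun x => Real.sqrt v * x) := by
  rw [gaussianReal_map_const_mul]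
  congr 1
  · simp
  · ext
    simp [Real.sq_sqrt hv, Real.coe_toNNReal v hv]

lemma integrable_pow_gaussianReal (v : ℝ≥0) (m : ℕ) :
    Integrable (fun x : ℝ => x ^ m) (gaussianReal 0 v) := by
  simpa using (memLp_id_gaussianReal (μ := 0) (v := v) m).integrable_norm_pow' |>.mono'
    (by fun_prop) (ae_of_all _ fun x => by simp)

lemma integral_gaussianReal_standard (f : ℝ → ℝ) :
    ∫ x, f x ∂(gaussianReal 0 1)
      = 1 / Real.sqrt (2 * Real.pi) * ∫ x, f x * Real.exp (-x ^ 2 / 2) := by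
  rw [integral_gaussianReal_eq_integral_smul one_ne_zero, ← integral_const_mul]
  refine integral_congr_ae (ae_of_all _ fun x => ?_)
  simp [gaussianPDFReal]
  ring

/-- By evenness the integral is twice that over the half-line, a Gamma integral, and `Γ(k + 1/2) =
(2k - 1)!! √π / 2^k`. -/
lemma integral_even_pow_mul_exp (k : ℕ) :
    ∫ x : ℝ, x ^ (2 * k) * Real.exp (-x ^ 2 / 2)
      = Real.sqrt (2 * Real.pi) * (Nat.doubleFactorial (2 * k - 1) : ℝ) := by
  have h1 : ∫ x : ℝ, x ^ (2 * k) * Real.exp (-x ^ 2 / 2)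
      = ∫ x : ℝ, (fun y : ℝ => y ^ (2 * k) * Real.exp (-y ^ 2 / 2)) |x| := by
    refine integral_congr_ae (ae_of_all _ fun x => ?_)
    simp only [sq_abs, pow_mul]
  have h2 : ∫ x : ℝ in Set.Ioi 0, x ^ (2 * k) * Real.exp (-x ^ 2 / 2)
      = ∫ x : ℝ in Set.Ioi 0, x ^ ((2 * k : ℕ) : ℝ) * Real.exp (-(1 / 2) * x ^ (2 : ℝ)) := by
    refine setIntegral_congr_fun measurableSet_Ioi fun x _ => ?_
    simp only [Real.rpow_natCast, Real.rpow_ofNat]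
    ring_nf
  rw [h1, integral_comp_abs (f := fun y : ℝ => y ^ (2 * k) * Real.exp (-y ^ 2 / 2)), h2,
    integral_rpow_mul_exp_neg_mul_rpow (by norm_num)
    (by linarith [Nat.cast_nonneg (α := ℝ) (2 * k)]) (by norm_num)]
  have h3 : (((2 * k : ℕ) : ℝ) + 1) / 2 = k + 1 / 2 := by push_cast; ring
  rw [neg_div, h3, Real.Gamma_nat_add_half, one_div (2 : ℝ), Real.inv_rpow (by norm_num),
    Real.rpow_neg (by norm_num), inv_inv, Real.rpow_add (by norm_num), Real.rpow_natCast,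
    Real.sqrt_mul (by norm_num), Real.sqrt_eq_rpow 2, one_div]
  field_simp

lemma integral_pow_gaussianReal {v : ℝ} (hv : 0 ≤ v) (m : ℕ) :
    ∫ x, x ^ m ∂(gaussianReal 0 v.toNNReal) = gaussianMoment v m := by
  unfold gaussianMoment
  split_ifs with hm
  -- Odd moments equal their own negatives, by the symmetry of the law.
  · have h : ∫ x, x ^ m ∂(gaussianReal 0 v.toNNReal)
        = ∫ x, (-x) ^ m ∂(gaussianReal 0 v.toNNReal) := by
      conv_lhs => rw [← neg_zero, ← gaussianReal_map_neg]
      rw [integral_map (by fun_prop) (by fun_prop)]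
    simp only [hm.neg_pow, integral_neg] at h
    linarith
  · obtain ⟨k, rfl⟩ := (Nat.not_odd_iff_even.mp hm).two_dvd
    rw [gaussianReal_eq_map_standard hv, integral_map (by fun_prop) (by fun_prop)]
    simp only [mul_pow]
    rw [integral_const_mul, integral_gaussianReal_standard, integral_even_pow_mul_exp]
    have : Real.sqrt (2 * Real.pi) ≠ 0 := by positivity
    field_simp

end Gaussian

/-! ### The kernel and the variance function. -/

namespace Params

variable (θ : Params)

lemma continuous_kernel (t : ℝ≥0) : Continuous (θ.kernel t) := by
  unfold kernel
  fun_prop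

lemma exp_mul_kernel (T u s : ℝ≥0) :
    Real.exp (-θ.speed * ((u : ℝ) - T)) * θ.kernel T s = θ.kernel u s := by
  unfold kernel
  rw [mul_left_comm, ← Real.exp_add]
  ring_nf

/-- For `H = 1/2` the kernel is constantly `1`; otherwise `speed ≠ 0` and the squared kernel has an
exponential antiderivative. -/
lemma integral_kernel_sq {T u : ℝ≥0} (hTu : T ≤ u) :
    ∫ s in Set.Ioc T u, θ.kernel u s ^ 2 ∂timeMeasure = θ.variance ((u : ℝ) - T) := by
  have hε := θ.ε_pos
  have hTu' : (T : ℝ) ≤ u := hTu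
  have h := setIntegral_timeMeasure T u
    (fun x => (θ.ε ^ (θ.H - 1 / 2) * Real.exp (-θ.speed * ((u : ℝ) - x))) ^ 2)
  refine Eq.trans h ?_
  rw [← intervalIntegral.integral_of_le hTu']
  unfold variance
  split_ifs with hH
  · simp [hH, speed]
  · have hlam : θ.speed ≠ 0 := by
      refine mul_ne_zero (fun h0 => hH ?_) (inv_ne_zero hε.ne')
      linarith
    have hd (x : ℝ) : HasDerivAt
        (fun x => (θ.ε ^ (θ.H - 1 / 2)) ^ 2 / (2 * θ.speed)
          * Real.exp (-(2 * θ.speed) * ((u : ℝ) - x)))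
        ((θ.ε ^ (θ.H - 1 / 2) * Real.exp (-θ.speed * ((u : ℝ) - x))) ^ 2) x := by
      have h1 : HasDerivAt (fun x : ℝ => -(2 * θ.speed) * ((u : ℝ) - x)) (2 * θ.speed) x := by
        refine (((hasDerivAt_id x).const_sub (u : ℝ)).const_mul (-(2 * θ.speed))).congr_deriv ?_
        ring
      refine ((h1.exp).const_mul ((θ.ε ^ (θ.H - 1 / 2)) ^ 2 / (2 * θ.speed))).congr_deriv ?_
      rw [mul_pow, ← Real.exp_nat_mul]
      field_simp
      push_cast
      ring_nf
    rw [intervalIntegral.integral_eq_sub_of_hasDerivAt (fun x _ => hd x)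
      (by apply Continuous.intervalIntegrable; fun_prop)]
    -- The factor `1 / ε` here cancels the one in `2 * speed = (1 - 2H) / ε`, leaving `ε^{2H} / (1 -
    -- 2H)`.
    have hpow : (θ.ε ^ (θ.H - 1 / 2)) ^ 2 = θ.ε ^ (2 * θ.H) / θ.ε := by
      rw [← Real.rpow_natCast, ← Real.rpow_mul hε.le, ← Real.rpow_sub_one hε.ne']
      congr 1
      push_cast
      ring
    have h2 : 2 * θ.speed = (1 - 2 * θ.H) * θ.ε⁻¹ := by unfold speed; ring
    have h3 : 1 - 2 * θ.H ≠ 0 := fun h0 => hH (by linarith)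
    rw [hpow, h2]
    simp only [sub_self, mul_zero, Real.exp_zero, neg_mul]
    field_simp

lemma variance_nonneg {τ : ℝ} (hτ : 0 ≤ τ) : 0 ≤ θ.variance τ := by
  have h := θ.integral_kernel_sq (zero_le (a := τ.toNNReal))
  rw [NNReal.coe_zero, sub_zero, Real.coe_toNNReal τ hτ] at h
  rw [← h]
  exact integral_nonneg fun _ => sq_nonneg _

lemma continuous_variance : Continuous θ.variance := by
  unfold variance
  split_ifs <;> fun_prop

lemma variance_pos {τ : ℝ} (hτ : 0 < τ) : 0 < θ.variance τ := by
  have hε := θ.ε_pos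
  unfold variance
  split_ifs with hH
  · exact hτ
  · have h1 : 0 < 1 - 2 * θ.H := by
      rcases θ.H_le.lt_or_eq with h | h
      · linarith
      · exact absurd h hH
    have h2 : Real.exp (-(1 - 2 * θ.H) * θ.ε⁻¹ * τ) < 1 := by
      rw [Real.exp_lt_one_iff, neg_mul, neg_mul]
      have : 0 < (1 - 2 * θ.H) * θ.ε⁻¹ * τ := by positivity
      linarith
    have h3 : 0 < 1 - Real.exp (-(1 - 2 * θ.H) * θ.ε⁻¹ * τ) := by linarith
    positivity

end Params

/-! ### Independence and law of the Ornstein-Uhlenbeck increment. -/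

section Independence

/-- Itô integrals are fixed only up to null sets, so `Y` need not be `m₁`-measurable itself;
changing it on a null set alters no probability. -/
lemma indep_comap_of_aestronglyMeasurable {P : Measure Ω} {m₁ m₂ : MeasurableSpace Ω} {Y : Ω → ℝ}
    (hY : AEStronglyMeasurable[m₁] Y P) (h : Indep m₁ m₂ P) :
    Indep (MeasurableSpace.comap Y inferInstance) m₂ P := by
  obtain ⟨Y', hY', hYY'⟩ := hY
  rw [Indep_iff] at h ⊢
  rintro _ t ⟨s, hs, rfl⟩ ht
  have e : (Y ⁻¹' s : Set Ω) =ᵐ[P] (Y' ⁻¹' s : Set Ω) := by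
    filter_upwards [hYY'] with ω hω
    change (Y ω ∈ s) = (Y' ω ∈ s)
    rw [hω]
  rw [measure_congr e, measure_congr (e.inter (ae_eq_refl t))]
  exact h _ t (hY'.measurable hs) ht

end Independence

section OrnsteinUhlenbeck

variable {𝓕 : Filtration ℝ≥0 mΩ} {P : Measure Ω} [IsProbabilityMeasure P] {W W' X : ℝ≥0 → Ω → ℝ}
  {θ : Params} {a b : ℝ≥0}

lemma hasGaussianLaw_integral_stepProcess {P : Measure Ω} (hW : IsBrownianReal W P)
    (f : ℝ≥0 → ℝ) (hab : a ≤ b)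
    (n : ℕ) : HasGaussianLaw ((stepProcess 𝓕 f hab n).integral W) P := by
  have h := hW.isGaussianProcess.hasGaussianLaw_increments (n := n + 1)
    (t := fun i => gridPoint a b n i)
  let L : (Fin (n + 1) → ℝ) →L[ℝ] ℝ :=
    ∑ i : Fin (n + 1), f (gridPoint a b n i) • ContinuousLinearMap.proj (R := ℝ) i
  have h2 := h.map_fun L
  have e : (stepProcess 𝓕 f hab n).integral W = fun ω => L fun i =>
      W (gridPoint a b n i.succ) ω - W (gridPoint a b n i.castSucc) ω := by
    funext ω
    simp only [L, sum_apply, smul_apply, ContinuousLinearMap.proj_apply, smul_eq_mul]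
    rfl
  rw [e]
  exact h2

lemma measurable_futureIncrements_integral_stepProcess (f : ℝ≥0 → ℝ) (hab : a ≤ b) (n : ℕ) :
    Measurable[futureIncrements W W' a] ((stepProcess 𝓕 f hab n).integral W) := by
  refine Finset.measurable_sum _ fun i _ => Measurable.const_mul ?_ _
  have hi := (stepProcess 𝓕 f hab n).le_left i
  have h := (measurable_futureIncrements_left W W' (hi.trans
    ((stepProcess 𝓕 f hab n).le_mid i))).sub (measurable_futureIncrements_left W W' hi)
  simpa only [Pi.sub_def, sub_sub_sub_cancel_right] using h

lemma Params.IsOU.memLp {P : Measure Ω} (hX : θ.IsOU 𝓕 P W X) (t : ℝ≥0) :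
    MemLp (X t) 2 P := (hX t).2.1

lemma Params.IsOU.memLp_G {P : Measure Ω} (hX : θ.IsOU 𝓕 P W X) (T u : ℝ≥0) :
    MemLp (θ.G X T u) 2 P :=
  (hX.memLp u).sub ((hX.memLp T).mul_const _)

lemma tendsto_eval_stepProcess_kernel (θ : Params) {T u : ℝ≥0} (hTu : T ≤ u) (t : ℝ≥0) :
    Filter.Tendsto
      (fun n => eLpNorm (fun z : ℝ≥0 × Ω =>
        (stepProcess 𝓕 (θ.kernel t) hTu n).eval z.1 z.2 - θ.kernel t z.1) 2
        ((timeMeasure.restrict (Set.Ioc T u)).prod P)) Filter.atTop (𝓝 0) :=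
  tendsto_eLpNorm_of_uniform (g := fun n r ω =>
    (stepProcess 𝓕 (θ.kernel t) hTu n).eval r ω - θ.kernel t r)
    fun _ hδ => stepProcess_uniform (θ.continuous_kernel t) hTu hδ

/-- The approximants of `X u` are chosen to be `e` times those of `X T` on `(0, T]`, followed by
steps on `(T, u]`; the kernel factorisation makes this legitimate. Subtracting `e` times the
convergence to `X T` leaves only the steps after `T`. -/
lemma Params.IsOU.tendsto_integral_stepProcess (hW : IsBrownianPair 𝓕 P W W')
    (hX : θ.IsOU 𝓕 P W X) {T u : ℝ≥0} (hTu : T ≤ u) :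
    Filter.Tendsto
      (fun n => eLpNorm
        (fun ω => (stepProcess 𝓕 (θ.kernel u) hTu n).integral W ω - θ.G X T u ω) 2 P)
      Filter.atTop (𝓝 0) := by
  have hB := hW.hasBrownianIncrements_left
  set e := Real.exp (-θ.speed * ((u : ℝ) - T)) with he
  have he0 : 0 ≤ e := (Real.exp_pos _).le
  let φ := stepProcess 𝓕 (θ.kernel u) hTu
  let ψ := stepProcess 𝓕 (θ.kernel T) (zero_le (a := T))
  let χ n := SimpleProcess.lin 0 u e 1 (ψ n) (φ n) le_rfl zero_le hTu le_rfl
  have h1 := (hX T).tendsto hB ψ (tendsto_eval_stepProcess_kernel θ _ T)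
  have h2 : Filter.Tendsto (fun n => eLpNorm (fun ω => (χ n).integral W ω - X u ω) 2 P)
      Filter.atTop (𝓝 0) := by
    refine (hX u).tendsto hB χ (tendsto_eLpNorm_of_uniform (g := fun n r ω =>
      (χ n).eval r ω - θ.kernel u r) fun δ hδ => ?_)
    -- The error before `T` is multiplied by `e`, and `e / (e + 1) ≤ 1` absorbs this without a bound
    -- on `e`.
    have hδ' : 0 < δ / (e + 1) := by positivity
    filter_upwards [stepProcess_uniform (Ω := Ω) (𝓕 := 𝓕) (θ.continuous_kernel u) hTu hδ,
      stepProcess_uniform (Ω := Ω) (𝓕 := 𝓕) (θ.continuous_kernel T) (zero_le (a := T)) hδ']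
      with n hn1 hn2 r hr ω
    simp only [χ, SimpleProcess.lin_eval, one_mul]
    by_cases hrT : r ≤ T
    · rw [SimpleProcess.eval_of_notMem (φ n) (fun h => h.1.not_ge hrT), add_zero,
        ← θ.exp_mul_kernel T u r, ← mul_sub, abs_mul, abs_of_nonneg he0]
      calc e * |(ψ n).eval r ω - θ.kernel T r| ≤ e * (δ / (e + 1)) :=
            mul_le_mul_of_nonneg_left (hn2 r ⟨hr.1, hrT⟩ ω) he0
        _ ≤ δ := by
            rw [← mul_div_assoc, div_le_iff₀ (by positivity)]
            nlinarith
    · rw [SimpleProcess.eval_of_notMem (ψ n) (fun h => hrT h.2), mul_zero, zero_add]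
      exact hn1 r ⟨not_le.mp hrT, hr.2⟩ ω
  have h3 := h2.add (ENNReal.Tendsto.const_mul h1 (Or.inr (ENNReal.ofReal_ne_top (r := e))))
  simp only [mul_zero, add_zero] at h3
  refine tendsto_of_tendsto_of_tendsto_of_le_of_le tendsto_const_nhds h3 (fun _ => zero_le)
    fun n => ?_
  have e1 : (fun ω => (φ n).integral W ω - θ.G X T u ω)
      = (fun ω => (χ n).integral W ω - X u ω) - e • fun ω => (ψ n).integral W ω - X T ω := by
    ext ω
    simp only [χ, SimpleProcess.lin_integral, Params.G, Pi.sub_apply, Pi.smul_apply, smul_eq_mul,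
      ← he]
    ring
  change eLpNorm (fun ω => (φ n).integral W ω - θ.G X T u ω) 2 P ≤ _
  rw [e1]
  refine (eLpNorm_sub_le (((χ n).memLp_integral hB).sub (hX.memLp u)).aestronglyMeasurable
    ((((ψ n).memLp_integral hB).sub (hX.memLp T)).const_smul e).aestronglyMeasurable
    one_le_two).trans ?_
  refine add_le_add le_rfl ?_
  rw [eLpNorm_const_smul, Real.enorm_eq_ofReal he0]
  exact le_rfl

lemma memLp_kernel (θ : Params) (T u t : ℝ≥0) :
    MemLp (fun z : ℝ≥0 × Ω => θ.kernel t z.1) 2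
      ((timeMeasure.restrict (Set.Ioc T u)).prod P) := by
  obtain ⟨C, hC⟩ := (isCompact_Icc (a := T) (b := u)).exists_bound_of_continuousOn
    (θ.continuous_kernel t).continuousOn
  refine MemLp.of_bound (by
    have := θ.continuous_kernel t
    exact (this.measurable.comp measurable_fst).aestronglyMeasurable) C ?_
  filter_upwards [ae_fst_mem_Ioc T u] with z hz using hC z.1 (Set.Ioc_subset_Icc_self hz)

lemma Params.IsOU.isItoIntegral_G (hW : IsBrownianPair 𝓕 P W W') (hX : θ.IsOU 𝓕 P W X)
    {T u : ℝ≥0} (hTu : T ≤ u) :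
    IsItoIntegral 𝓕 P W T u (fun s _ => θ.kernel u s) (θ.G X T u) :=
  ⟨memLp_kernel θ T u u, hX.memLp_G T u, stepProcess 𝓕 (θ.kernel u) hTu,
    tendsto_eval_stepProcess_kernel θ hTu u, hX.tendsto_integral_stepProcess hW hTu⟩

lemma Params.IsOU.aestronglyMeasurable_G (hW : IsBrownianPair 𝓕 P W W') (hX : θ.IsOU 𝓕 P W X)
    {T u : ℝ≥0} (hTu : T ≤ u) :
    AEStronglyMeasurable[futureIncrements W W' T] (θ.G X T u) P :=
  aestronglyMeasurable_of_tendsto_eLpNorm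
    (fun _ => SimpleProcess.memLp_integral hW.hasBrownianIncrements_left _) (hX.memLp_G T u)
    (fun n => measurable_futureIncrements_integral_stepProcess (W' := W') _ hTu n)
    (hX.tendsto_integral_stepProcess hW hTu)

lemma Params.IsOU.indep_G (hW : IsBrownianPair 𝓕 P W W') (hX : θ.IsOU 𝓕 P W X)
    {T u : ℝ≥0} (hTu : T ≤ u) :
    Indep (MeasurableSpace.comap (θ.G X T u) inferInstance) (𝓕 T) P :=
  indep_comap_of_aestronglyMeasurable (hX.aestronglyMeasurable_G hW hTu) (hW.indep_increments T)

/-- The isometry for simple processes passes to the limit on both sides. -/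
lemma Params.IsOU.integral_G_sq (hW : IsBrownianPair 𝓕 P W W') (hX : θ.IsOU 𝓕 P W X)
    {T u : ℝ≥0} (hTu : T ≤ u) :
    ∫ ω, θ.G X T u ω ^ 2 ∂P = θ.variance ((u : ℝ) - T) := by
  have hB := hW.hasBrownianIncrements_left
  have h1 := tendsto_integral_sq (fun n => SimpleProcess.memLp_integral hB _) (hX.memLp_G T u)
    (hX.tendsto_integral_stepProcess hW hTu)
  have h2 := tendsto_integral_sq (fun n => SimpleProcess.memLp_eval (P := P) _ T u)
    (memLp_kernel θ T u u) (tendsto_eval_stepProcess_kernel (𝓕 := 𝓕) θ hTu u)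
  simp only [SimpleProcess.integral_integral_sq hB] at h1
  rw [tendsto_nhds_unique h1 h2, ← θ.integral_kernel_sq hTu,
    integral_fun_fst (fun s => θ.kernel u s ^ 2)]
  simp

lemma Params.IsOU.hasLaw_G (hW : IsBrownianPair 𝓕 P W W') (hX : θ.IsOU 𝓕 P W X)
    {T u : ℝ≥0} (hTu : T ≤ u) :
    HasLaw (θ.G X T u) (gaussianReal 0 (Real.toNNReal (θ.variance ((u : ℝ) - T)))) P := by
  rw [← hX.integral_G_sq hW hTu]
  refine hasLaw_gaussianReal_of_tendsto_eLpNorm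
    (fun n => hasGaussianLaw_integral_stepProcess hW.brownian_left _ _ n) (fun n => ?_)
    (hX.memLp_G T u) (hX.tendsto_integral_stepProcess hW hTu)
  simpa using SimpleProcess.setIntegral_integral_eq_zero hW.hasBrownianIncrements_left
    (stepProcess 𝓕 (θ.kernel u) hTu n) (A := Set.univ) MeasurableSet.univ

lemma Params.IsOU.integral_G_pow (hW : IsBrownianPair 𝓕 P W W') (hX : θ.IsOU 𝓕 P W X)
    {T u : ℝ≥0} (hTu : T ≤ u) (m : ℕ) :
    ∫ ω, θ.G X T u ω ^ m ∂P = gaussianMoment (θ.variance ((u : ℝ) - T)) m := by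
  rw [← integral_pow_gaussianReal (θ.variance_nonneg (sub_nonneg.mpr (NNReal.coe_le_coe.mpr hTu))),
    ← (hX.hasLaw_G hW hTu).map_eq, integral_map (hX.hasLaw_G hW hTu).aemeasurable (by fun_prop)]

lemma Params.IsOU.integrable_G_pow (hW : IsBrownianPair 𝓕 P W W') (hX : θ.IsOU 𝓕 P W X)
    {T u : ℝ≥0} (hTu : T ≤ u) (m : ℕ) : Integrable (fun ω => θ.G X T u ω ^ m) P := by
  have h := integrable_pow_gaussianReal (Real.toNNReal (θ.variance ((u : ℝ) - T))) m
  rw [← (hX.hasLaw_G hW hTu).map_eq] at h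
  exact (integrable_map_measure (continuous_pow m).aestronglyMeasurable
    (hX.hasLaw_G hW hTu).aemeasurable).mp h

/-- An integral over an empty interval is zero. Hence `X t` agrees a.s. with `G` started at time
`0`, and its law and moments follow from those of `G`. -/
lemma Params.IsOU.zero_ae_eq (hW : IsBrownianPair 𝓕 P W W') (hX : θ.IsOU 𝓕 P W X) :
    X 0 =ᵐ[P] 0 := by
  have hB := hW.hasBrownianIncrements_left
  have h := (hX 0).tendsto hB (fun n => stepProcess 𝓕 (θ.kernel 0) le_rfl n)
    (tendsto_eval_stepProcess_kernel θ le_rfl 0)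
  have h0 (n : ℕ) (ω : Ω) :
      (stepProcess 𝓕 (θ.kernel 0) (le_refl (0 : ℝ≥0)) n).integral W ω = 0 := by
    refine Finset.sum_eq_zero fun i _ => ?_
    have hs := (stepProcess 𝓕 (θ.kernel 0) (le_refl (0 : ℝ≥0)) n).le_right i
    have := le_antisymm hs zero_le
    rw [this, le_antisymm ((SimpleProcess.le_mid _ i).trans hs) zero_le, sub_self, mul_zero]
  simp only [h0, zero_sub] at h
  have h' := tendsto_nhds_unique h tendsto_const_nhds
  have h'' := (eLpNorm_eq_zero_iff (hX.memLp 0).neg.aestronglyMeasurable two_ne_zero).mp h'.symm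
  filter_upwards [h''] with ω hω
  simpa using hω

lemma Params.IsOU.G_zero_ae_eq (hW : IsBrownianPair 𝓕 P W W') (hX : θ.IsOU 𝓕 P W X) (t : ℝ≥0) :
    θ.G X 0 t =ᵐ[P] X t := by
  filter_upwards [hX.zero_ae_eq hW] with ω hω
  simp [Params.G, hω]

lemma Params.IsOU.hasLaw (hW : IsBrownianPair 𝓕 P W W') (hX : θ.IsOU 𝓕 P W X) (t : ℝ≥0) :
    HasLaw (X t) (gaussianReal 0 (Real.toNNReal (θ.variance t))) P := by
  have h := hX.hasLaw_G hW (zero_le (a := t))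
  rw [NNReal.coe_zero, sub_zero] at h
  exact h.congr (hX.G_zero_ae_eq hW t).symm

lemma Params.IsOU.integrable_pow (hW : IsBrownianPair 𝓕 P W W') (hX : θ.IsOU 𝓕 P W X) (t : ℝ≥0)
    (m : ℕ) : Integrable (fun ω => X t ω ^ m) P := by
  refine (hX.integrable_G_pow hW (zero_le (a := t)) m).congr ?_
  filter_upwards [hX.G_zero_ae_eq hW t] with ω hω
  rw [hω]

lemma Params.IsOU.aestronglyMeasurable (hW : IsBrownianPair 𝓕 P W W') (hX : θ.IsOU 𝓕 P W X)
    (t : ℝ≥0) : AEStronglyMeasurable[𝓕 t] (X t) P := by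
  have hB := hW.hasBrownianIncrements_left
  exact aestronglyMeasurable_of_tendsto_eLpNorm
    (fun n => SimpleProcess.memLp_integral hB _) (hX.memLp t)
    (fun n => SimpleProcess.measurable_integral hB _)
    ((hX t).tendsto hB (fun n => stepProcess 𝓕 (θ.kernel t) zero_le n)
      (tendsto_eval_stepProcess_kernel θ _ t))

end OrnsteinUhlenbeck

/-! ### Signs and continuity of moments, and the expansion of the squared polynomial. -/

lemma gaussianMoment_nonneg (v : ℝ) (m : ℕ) : 0 ≤ gaussianMoment v m := by
  unfold gaussianMoment
  split_ifs <;> positivity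

lemma gaussianMoment_pos {v : ℝ} (hv : 0 < v) {m : ℕ} (hm : Even m) : 0 < gaussianMoment v m := by
  unfold gaussianMoment
  rw [if_neg (Nat.not_odd_iff_even.mpr hm)]
  have := Nat.doubleFactorial_pos (m - 1)
  positivity

lemma continuous_gaussianMoment (m : ℕ) : Continuous fun v => gaussianMoment v m := by
  unfold gaussianMoment
  split_ifs <;> fun_prop

/-- A conditional expectation given an independent σ-algebra is constant, for integrands that are
only a.e. measurable. -/
lemma condExp_ae_eq_integral_of_indep {P : Measure Ω} [IsFiniteMeasure P]
    {m₁ m₂ : MeasurableSpace Ω} (hm₁ : m₁ ≤ mΩ) (hm₂ : m₂ ≤ mΩ) {Y : Ω → ℝ}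
    (hY : AEStronglyMeasurable[m₁] Y P) (h : Indep m₁ m₂ P) :
    P[Y | m₂] =ᵐ[P] fun _ => ∫ ω, Y ω ∂P := by
  obtain ⟨Y', hY', hYY'⟩ := hY
  refine (condExp_congr_ae hYY').trans ?_
  rw [integral_congr_ae hYY']
  exact condExp_indep_eq hm₁ hm₂ hY' h

namespace Params

variable (θ : Params)

lemma α_nonneg (k : ℕ) : 0 ≤ θ.α k := by
  unfold α
  split
  exacts [θ.α₀_nonneg, θ.α₁_nonneg, θ.α₃_nonneg, θ.α₅_nonneg, le_rfl]

lemma conv_nonneg (k : ℕ) : 0 ≤ θ.conv k :=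
  Finset.sum_nonneg fun _ _ => mul_nonneg (θ.α_nonneg _) (θ.α_nonneg _)

lemma p_sq (x : ℝ) : θ.p x ^ 2 = ∑ k ∈ Finset.range 11, θ.conv k * x ^ k := by
  simp only [p, conv, α, Finset.sum_range_succ, Finset.sum_range_zero]
  norm_num
  ring

lemma p_add_sq (x y : ℝ) : θ.p (x + y) ^ 2 = ∑ k ∈ Finset.range 11, ∑ i ∈ Finset.range (k + 1),
    θ.conv k * (k.choose i : ℝ) * x ^ i * y ^ (k - i) := by
  rw [p_sq]
  refine Finset.sum_congr rfl fun k _ => ?_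
  rw [add_pow, Finset.mul_sum]
  exact Finset.sum_congr rfl fun i _ => by ring

/-- The forward variance `ξ_T(u)` as a polynomial in the value `x` of `X_T`. -/
def forwardVariance (P : Measure Ω) (X : ℝ≥0 → Ω → ℝ) (T u : ℝ≥0) (x : ℝ) : ℝ :=
  ∑ k ∈ Finset.range 11, ∑ i ∈ Finset.range (k + 1),
    θ.conv k * (k.choose i : ℝ) * (θ.βIntegrand P X T (k - i) i u * x ^ i)

lemma forwardVariance_eq (P : Measure Ω) (X : ℝ≥0 → Ω → ℝ) (T u : ℝ≥0) (x : ℝ) :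
    θ.forwardVariance P X T u x = θ.ξ₀ u / θ.g P X u * ∑ k ∈ Finset.range 11,
      ∑ i ∈ Finset.range (k + 1), θ.conv k * (k.choose i : ℝ) *
        (x * Real.exp (-θ.speed * ((u : ℝ) - T))) ^ i * ∫ ω, θ.G X T u ω ^ (k - i) ∂P := by
  unfold forwardVariance βIntegrand
  simp only [Finset.mul_sum]
  refine Finset.sum_congr rfl fun k _ => Finset.sum_congr rfl fun i _ => ?_
  rw [mul_pow, ← Real.exp_nat_mul, mul_comm (i : ℝ)]
  ring

lemma g_nonneg (P : Measure Ω) (X : ℝ≥0 → Ω → ℝ) (u : ℝ≥0) : 0 ≤ θ.g P X u :=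
  integral_nonneg fun _ => sq_nonneg _

lemma σ_sq (P : Measure Ω) (X : ℝ≥0 → Ω → ℝ) (u : ℝ≥0) (ω : Ω) :
    θ.σ P X u ω ^ 2 = θ.ξ₀ u / θ.g P X u * θ.p (X u ω) ^ 2 := by
  unfold σ
  rw [mul_pow, div_pow, Real.sq_sqrt (θ.ξ₀_nonneg u), Real.sq_sqrt (θ.g_nonneg P X u)]
  ring

end Params

/-! ### The normalisation `g` and the forward variance. -/

section ForwardVariance

variable {𝓕 : Filtration ℝ≥0 mΩ} {P : Measure Ω} [IsProbabilityMeasure P] {W W' X : ℝ≥0 → Ω → ℝ}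
  {θ : Params} {T u : ℝ≥0}

lemma Params.IsOU.integral_pow (hW : IsBrownianPair 𝓕 P W W') (hX : θ.IsOU 𝓕 P W X) (t : ℝ≥0)
    (m : ℕ) : ∫ ω, X t ω ^ m ∂P = gaussianMoment (θ.variance t) m := by
  rw [← integral_pow_gaussianReal (θ.variance_nonneg t.coe_nonneg),
    ← (hX.hasLaw hW t).map_eq, integral_map (hX.hasLaw hW t).aemeasurable (by fun_prop)]

lemma Params.IsOU.g_eq (hW : IsBrownianPair 𝓕 P W W') (hX : θ.IsOU 𝓕 P W X) (u : ℝ≥0) :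
    θ.g P X u = ∑ k ∈ Finset.range 11, θ.conv k * gaussianMoment (θ.variance u) k := by
  unfold Params.g
  simp only [θ.p_sq]
  rw [integral_finsetSum _ fun k _ => (hX.integrable_pow hW u k).const_mul _]
  simp only [integral_const_mul, hX.integral_pow hW]

lemma Params.IsOU.continuous_g (hW : IsBrownianPair 𝓕 P W W') (hX : θ.IsOU 𝓕 P W X) :
    Continuous (θ.g P X) := by
  have h : θ.g P X = fun u : ℝ≥0 => ∑ k ∈ Finset.range 11,
      θ.conv k * gaussianMoment (θ.variance u) k := funext (hX.g_eq hW)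
  rw [h]
  exact continuous_finsetSum _ fun k _ => continuous_const.mul
    ((continuous_gaussianMoment k).comp (θ.continuous_variance.comp NNReal.continuous_coe))

/-- All terms of the expansion of `g` are nonnegative, so one positive term suffices. If `α_j > 0`,
then `(α*α)_{2j} ≥ α_j²`, and the moment of order `2j` is positive when the variance is, or when `j
= 0`; hence the role of `α₀` at time zero. -/
lemma Params.IsOU.g_pos (hW : IsBrownianPair 𝓕 P W W') (hX : θ.IsOU 𝓕 P W X) {u : ℝ≥0}
    (hu : 0 < u ∨ 0 < θ.α₀) : 0 < θ.g P X u := by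
  rw [hX.g_eq hW]
  have h0 (k : ℕ) : 0 ≤ θ.conv k * gaussianMoment (θ.variance u) k :=
    mul_nonneg (θ.conv_nonneg k) (gaussianMoment_nonneg _ _)
  have key (k : ℕ) (hk : k ∈ Finset.range 11)
      (h : 0 < θ.conv k * gaussianMoment (θ.variance u) k) :
      0 < ∑ k ∈ Finset.range 11, θ.conv k * gaussianMoment (θ.variance u) k :=
    h.trans_le (Finset.single_le_sum (f := fun k => θ.conv k * gaussianMoment (θ.variance u) k)
      (fun i _ => h0 i) hk)
  have hconv (j : ℕ) (hj : 0 < θ.α j) : 0 < θ.conv (j + j) := by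
    refine lt_of_lt_of_le (mul_pos hj hj) ?_
    have := Finset.single_le_sum (f := fun i => θ.α i * θ.α (j + j - i))
      (fun i _ => mul_nonneg (θ.α_nonneg _) (θ.α_nonneg _))
      (Finset.mem_range.mpr (by omega : j < j + j + 1))
    simpa [Params.conv] using this
  by_cases hα : 0 < θ.α₀
  · refine key 0 (by simp) (mul_pos (hconv 0 hα) ?_)
    simp [gaussianMoment]
  · have hv : 0 < θ.variance u := θ.variance_pos (NNReal.coe_pos.mpr (hu.resolve_right hα))
    have hpos (j : ℕ) (hj : 0 < θ.α j) (hj5 : j ≤ 5) :=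
      key (j + j) (Finset.mem_range.mpr (by omega))
        (mul_pos (hconv j hj) (gaussianMoment_pos hv ⟨j, rfl⟩))
    by_cases h1 : 0 < θ.α₁
    · exact hpos 1 h1 (by norm_num)
    by_cases h3 : 0 < θ.α₃
    · exact hpos 3 h3 (by norm_num)
    by_cases h5 : 0 < θ.α₅
    · exact hpos 5 h5 (by norm_num)
    exact absurd ⟨le_antisymm (not_lt.mp hα) θ.α₀_nonneg, le_antisymm (not_lt.mp h1) θ.α₁_nonneg,
      le_antisymm (not_lt.mp h3) θ.α₃_nonneg, le_antisymm (not_lt.mp h5) θ.α₅_nonneg⟩ θ.α_ne_zero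

lemma Params.IsOU.integrable_p_sq (hW : IsBrownianPair 𝓕 P W W') (hX : θ.IsOU 𝓕 P W X) (u : ℝ≥0) :
    Integrable (fun ω => θ.p (X u ω) ^ 2) P := by
  simp only [θ.p_sq]
  exact integrable_finsetSum _ fun k _ => (hX.integrable_pow hW u k).const_mul _

lemma Params.IsOU.integrable_σ_sq (hW : IsBrownianPair 𝓕 P W W') (hX : θ.IsOU 𝓕 P W X) (u : ℝ≥0) :
    Integrable (fun ω => θ.σ P X u ω ^ 2) P := by
  simp only [θ.σ_sq]
  exact (hX.integrable_p_sq hW u).const_mul _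

/-- The polynomial is `ξ₀ / g` times the mean of `p(x e^{-λ(u-T)} + G)²`. This works for every real
`x`, not merely for almost every value of `X_T`, as nonnegativity of `h` on the whole line requires.
-/
lemma Params.IsOU.forwardVariance_nonneg (hW : IsBrownianPair 𝓕 P W W') (hX : θ.IsOU 𝓕 P W X)
    (hTu : T ≤ u) (x : ℝ) : 0 ≤ θ.forwardVariance P X T u x := by
  rw [θ.forwardVariance_eq]
  refine mul_nonneg (div_nonneg (θ.ξ₀_nonneg u) (θ.g_nonneg P X u)) ?_
  have h : ∫ ω, θ.p (x * Real.exp (-θ.speed * ((u : ℝ) - T)) + θ.G X T u ω) ^ 2 ∂P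
      = ∑ k ∈ Finset.range 11, ∑ i ∈ Finset.range (k + 1), θ.conv k * (k.choose i : ℝ) *
        (x * Real.exp (-θ.speed * ((u : ℝ) - T))) ^ i * ∫ ω, θ.G X T u ω ^ (k - i) ∂P := by
    simp only [θ.p_add_sq]
    rw [integral_finsetSum _ fun k _ => integrable_finsetSum _ fun i _ =>
      (hX.integrable_G_pow hW hTu (k - i)).const_mul _]
    refine Finset.sum_congr rfl fun k _ => ?_
    rw [integral_finsetSum _ fun i _ => (hX.integrable_G_pow hW hTu (k - i)).const_mul _]
    simp only [integral_const_mul]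
  rw [← h]
  exact integral_nonneg fun _ => sq_nonneg _

lemma memLp_two_pow {P : Measure Ω} {Y : Ω → ℝ} (hm : AEStronglyMeasurable Y P)
    (hY : ∀ m : ℕ, Integrable (fun ω => Y ω ^ m) P) (m : ℕ) : MemLp (fun ω => Y ω ^ m) 2 P := by
  refine (memLp_two_iff_integrable_sq (f := fun ω => Y ω ^ m) (hm.pow m)).mpr ?_
  simpa only [← pow_mul] using hY (m * 2)

lemma Params.IsOU.condExp_p_sq (hW : IsBrownianPair 𝓕 P W W') (hX : θ.IsOU 𝓕 P W X)
    (hTu : T ≤ u) :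
    P[fun ω => θ.p (X u ω) ^ 2 | 𝓕 T] =ᵐ[P] fun ω => ∑ k ∈ Finset.range 11,
      ∑ i ∈ Finset.range (k + 1), θ.conv k * (k.choose i : ℝ) *
        (X T ω * Real.exp (-θ.speed * ((u : ℝ) - T))) ^ i * ∫ ω', θ.G X T u ω' ^ (k - i) ∂P := by
  set e := Real.exp (-θ.speed * ((u : ℝ) - T)) with he
  let c (k i : ℕ) (ω : Ω) : ℝ := θ.conv k * (k.choose i : ℝ) * (X T ω * e) ^ i
  let Z (j : ℕ) (ω : Ω) : ℝ := θ.G X T u ω ^ j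
  have hZ (j : ℕ) : Integrable (Z j) P := hX.integrable_G_pow hW hTu j
  -- All powers of `X T` and of `G` are in L², so their products are integrable.
  have hcZ (k i j : ℕ) : Integrable (c k i * Z j) P := by
    have h := (memLp_two_pow (hX.memLp T).aestronglyMeasurable (hX.integrable_pow hW T) i
      ).integrable_mul
      (memLp_two_pow (hX.memLp_G T u).aestronglyMeasurable (hX.integrable_G_pow hW hTu) j)
    refine (h.const_mul (θ.conv k * (k.choose i : ℝ) * e ^ i)).congr (ae_of_all _ fun ω => ?_)
    simp only [c, Z, Pi.mul_apply]
    ring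
  have e1 : (fun ω => θ.p (X u ω) ^ 2)
      = ∑ k ∈ Finset.range 11, ∑ i ∈ Finset.range (k + 1), c k i * Z (k - i) := by
    ext ω
    have : X u ω = X T ω * e + θ.G X T u ω := by simp only [G, he]; ring
    rw [this, θ.p_add_sq]
    simp only [Finset.sum_apply, Pi.mul_apply, c, Z]
  have hterm (k i j : ℕ) : P[c k i * Z j | 𝓕 T] =ᵐ[P] fun ω => c k i ω * ∫ ω', Z j ω' ∂P := by
    have hc : AEStronglyMeasurable[𝓕 T] (c k i) P :=
      (((hX.aestronglyMeasurable hW T).mul_const e).pow i).const_mul _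
    refine (condExp_mul_of_aestronglyMeasurable_left hc (hcZ k i j) (hZ j)).trans ?_
    have h := condExp_ae_eq_integral_of_indep (hW.futureIncrements_le T) (𝓕.le T)
      ((hX.aestronglyMeasurable_G hW hTu).pow j) (hW.indep_increments T)
    filter_upwards [h] with ω hω
    rw [Pi.mul_apply]
    congr 1
  rw [e1]
  have h1 := condExp_finsetSum (s := Finset.range 11)
    (f := fun k => ∑ i ∈ Finset.range (k + 1), c k i * Z (k - i)) (μ := P)
    (fun k _ => integrable_finsetSum' _ fun i _ => hcZ k i (k - i)) (𝓕 T)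
  have h2 (k : ℕ) := condExp_finsetSum (s := Finset.range (k + 1))
    (f := fun i => c k i * Z (k - i)) (μ := P) (fun i _ => hcZ k i (k - i)) (𝓕 T)
  have h2' := ae_all_iff.mpr h2
  have h3 := ae_all_iff.mpr fun k => ae_all_iff.mpr fun i => hterm k i (k - i)
  filter_upwards [h1, h2', h3] with ω a1 a2 a3
  rw [a1, Finset.sum_apply]
  refine Finset.sum_congr rfl fun k _ => ?_
  rw [a2 k, Finset.sum_apply]
  exact Finset.sum_congr rfl fun i _ => a3 k i

lemma Params.IsOU.condExp_σ_sq (hW : IsBrownianPair 𝓕 P W W') (hX : θ.IsOU 𝓕 P W X)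
    (hTu : T ≤ u) :
    P[fun ω => θ.σ P X u ω ^ 2 | 𝓕 T] =ᵐ[P] fun ω => θ.forwardVariance P X T u (X T ω) := by
  have e : (fun ω => θ.σ P X u ω ^ 2)
      = (θ.ξ₀ u / θ.g P X u) • fun ω => θ.p (X u ω) ^ 2 := funext (θ.σ_sq P X u)
  rw [e]
  refine (condExp_smul _ _ _).trans ?_
  filter_upwards [hX.condExp_p_sq hW hTu] with ω hω
  rw [Pi.smul_apply, hω, θ.forwardVariance_eq, smul_eq_mul]

/-- Apart from `ξ₀`, which is integrable, the integrand is continuous on the compact `[T, S]` and so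
bounded. The endpoint `T` is included, which is where `g T > 0` matters. -/
lemma Params.IsOU.integrableOn_βIntegrand (hW : IsBrownianPair 𝓕 P W W') (hX : θ.IsOU 𝓕 P W X)
    (hT : 0 < T ∨ 0 < θ.α₀) (S : ℝ≥0) (m i : ℕ) :
    IntegrableOn (θ.βIntegrand P X T m i) (Set.Ioc T S) timeMeasure := by
  have hsub : Set.Ioc T S ⊆ Set.Icc 0 S := fun _ hx => ⟨zero_le, hx.2⟩
  have hξ : IntegrableOn θ.ξ₀ (Set.Ioc T S) timeMeasure :=
    ((θ.ξ₀_memLp S).mono_measure (Measure.restrict_mono_set _ hsub)).integrable one_le_two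
  let F (u : ℝ≥0) : ℝ := gaussianMoment (θ.variance ((u : ℝ) - T)) m / θ.g P X u *
    Real.exp (-θ.speed * ((u : ℝ) - T) * i)
  have hF : ContinuousOn F (Set.Icc T S) := by
    refine ContinuousOn.mul (ContinuousOn.div ?_ (hX.continuous_g hW).continuousOn ?_) ?_
    · exact ((continuous_gaussianMoment m).comp (θ.continuous_variance.comp
        (NNReal.continuous_coe.sub continuous_const))).continuousOn
    · exact fun u hu => (hX.g_pos hW (hT.imp_left fun h => h.trans_le hu.1)).ne'
    · exact Continuous.continuousOn (by fun_prop)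
  obtain ⟨C, hC⟩ := isCompact_Icc.exists_bound_of_continuousOn hF
  have h := Integrable.bdd_mul hξ
    ((hF.mono Set.Ioc_subset_Icc_self).aestronglyMeasurable measurableSet_Ioc)
    ((ae_restrict_mem measurableSet_Ioc).mono fun u hu => hC u (Set.Ioc_subset_Icc_self hu))
  refine h.congr ((ae_restrict_mem measurableSet_Ioc).mono fun u hu => ?_)
  simp only [F, βIntegrand]
  rw [hX.integral_G_pow hW hu.1.le]
  ring

end ForwardVariance

/-- Two jointly a.e. measurable functions that agree a.e. in the second variable, for a.e. value of
the first, agree a.e. for the product measure. -/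
lemma ae_eq_prod_of_ae_ae_eq {α β : Type*} {mα : MeasurableSpace α} {mβ : MeasurableSpace β}
    {μ : Measure α} {ν : Measure β} [SFinite ν] {f g : α × β → ℝ}
    (hf : AEStronglyMeasurable f (μ.prod ν)) (hg : AEStronglyMeasurable g (μ.prod ν))
    (h : ∀ᵐ x ∂μ, ∀ᵐ y ∂ν, f (x, y) = g (x, y)) : f =ᵐ[μ.prod ν] g := by
  have hs := hf.stronglyMeasurable_mk.measurableSet_eq_fun hg.stronglyMeasurable_mk
  have hmk : ∀ᵐ z ∂(μ.prod ν), hf.mk f z = hg.mk g z := by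
    rw [Measure.ae_prod_iff_ae_ae hs]
    filter_upwards [h, Measure.ae_ae_of_ae_prod hf.ae_eq_mk, Measure.ae_ae_of_ae_prod hg.ae_eq_mk]
      with x h1 h2 h3
    filter_upwards [h1, h2, h3] with y e1 e2 e3
    rw [← e2, ← e3, e1]
  filter_upwards [hf.ae_eq_mk, hmk, hg.ae_eq_mk] with z e1 e2 e3
  rw [e1, e2, ← e3]

lemma ae_ae_swap_of_ae_prod {α β : Type*} {mα : MeasurableSpace α} {mβ : MeasurableSpace β}
    {μ : Measure α} {ν : Measure β} [SFinite μ] [SFinite ν] {q : α × β → Prop}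
    (h : ∀ᵐ z ∂(μ.prod ν), q z) : ∀ᵐ y ∂ν, ∀ᵐ x ∂μ, q (x, y) :=
  Measure.ae_ae_of_ae_prod (p := fun z : β × α => q z.swap)
    (Measure.measurePreserving_swap.quasiMeasurePreserving.ae h)

/-! ### Conditional mean of the Itô integral. -/

section Martingale

variable {𝓕 : Filtration ℝ≥0 mΩ} {P : Measure Ω} [IsProbabilityMeasure P] {B : ℝ≥0 → Ω → ℝ}

/-- The martingale property of the Itô integral. -/
lemma IsItoIntegral.setIntegral_eq (hB : HasBrownianIncrements 𝓕 P B) {a T b : ℝ≥0} (haT : a ≤ T)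
    (hTb : T ≤ b) {f : ℝ≥0 → Ω → ℝ} {Y Z : Ω → ℝ} (hY : IsItoIntegral 𝓕 P B a b f Y)
    (hZ : IsItoIntegral 𝓕 P B a T f Z) {A : Set Ω} (hA : MeasurableSet[𝓕 T] A) :
    ∫ ω in A, Y ω ∂P = ∫ ω in A, Z ω ∂P := by
  obtain ⟨-, hY2, φ, hφ, hφY⟩ := hY
  have hle : (timeMeasure.restrict (Set.Ioc a T)).prod P
      ≤ (timeMeasure.restrict (Set.Ioc a b)).prod P :=
    Measure.prod_mono (Measure.restrict_mono_set _ (Set.Ioc_subset_Ioc_right hTb)) le_rfl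
  -- The truncations still approximate `f` on `(a, T]`, so their integrals converge to `Z`; the
  -- discarded parts after `T` have zero integral over `A`.
  have hψ := hZ.tendsto hB (fun n => (φ n).before T haT) <| by
    refine tendsto_of_tendsto_of_tendsto_of_le_of_le tendsto_const_nhds hφ (fun _ => zero_le)
      fun n => le_trans (le_of_eq ?_) (eLpNorm_mono_measure _ hle)
    refine eLpNorm_congr_ae ?_
    filter_upwards [ae_fst_mem_Ioc a T] with z hz
    rw [SimpleProcess.before_eval _ haT hz.2]
  have h1 := tendsto_setIntegral_of_tendsto_eLpNorm (fun n => (φ n).memLp_integral hB) hY2 hφY A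
  have h2 := tendsto_setIntegral_of_tendsto_eLpNorm
    (fun n => ((φ n).before T haT).memLp_integral hB) hZ.2.1 hψ A
  refine tendsto_nhds_unique h1 (h2.congr fun n => ?_)
  simp only [← (φ n).before_add_after_integral haT hTb]
  rw [integral_add
    ((((φ n).before T haT).memLp_integral hB).integrable one_le_two).integrableOn
    ((((φ n).after T hTb).memLp_integral hB).integrable one_le_two).integrableOn,
    SimpleProcess.setIntegral_integral_eq_zero hB _ hA, add_zero]

end Martingale

/-! ### The log-contract and the squared VIX. -/

section VIX

variable {𝓕 : Filtration ℝ≥0 mΩ} {P : Measure Ω} [IsProbabilityMeasure P]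
  {W W' X S : ℝ≥0 → Ω → ℝ} {θ : Params} {T Δ : ℝ≥0}

lemma Params.IsOU.integrable_forwardVariance_left (hW : IsBrownianPair 𝓕 P W W')
    (hX : θ.IsOU 𝓕 P W X) (hT : 0 < T ∨ 0 < θ.α₀) (b : ℝ≥0) (x : ℝ) :
    IntegrableOn (fun u => θ.forwardVariance P X T u x) (Set.Ioc T b) timeMeasure :=
  integrable_finsetSum _ fun k _ => integrable_finsetSum _ fun i _ =>
    ((hX.integrableOn_βIntegrand hW hT b (k - i) i).mul_const _).const_mul _

lemma Params.IsOU.integrable_forwardVariance (hW : IsBrownianPair 𝓕 P W W')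
    (hX : θ.IsOU 𝓕 P W X) (hT : 0 < T ∨ 0 < θ.α₀) (b : ℝ≥0) :
    Integrable (fun z : ℝ≥0 × Ω => θ.forwardVariance P X T z.1 (X T z.2))
      ((timeMeasure.restrict (Set.Ioc T b)).prod P) :=
  integrable_finsetSum _ fun k _ => integrable_finsetSum _ fun i _ =>
    ((hX.integrableOn_βIntegrand hW hT b (k - i) i).mul_prod
      (hX.integrable_pow hW T i)).const_mul _

/-- Powers of `x` are collected by exchanging the sums over `0 ≤ i ≤ k ≤ 10`. -/
lemma Params.IsOU.integral_forwardVariance (hW : IsBrownianPair 𝓕 P W W')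
    (hX : θ.IsOU 𝓕 P W X) (hT : 0 < T ∨ 0 < θ.α₀) (Δ : ℝ≥0) (x : ℝ) :
    ∫ u in Set.Ioc T (T + Δ), θ.forwardVariance P X T u x ∂timeMeasure
      = ∑ i ∈ Finset.range 11, θ.β P X T Δ i * x ^ i := by
  have hI (m i : ℕ) := (hX.integrableOn_βIntegrand hW hT (T + Δ) m i).mul_const (x ^ i)
  unfold Params.forwardVariance Params.β
  rw [integral_finsetSum _ fun k _ => integrable_finsetSum _ fun i _ =>
    (hI (k - i) i).const_mul _]
  simp only [Finset.sum_mul]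
  rw [Finset.sum_comm' (s := Finset.range 11) (t := fun i => Finset.Icc i 10)
    (t' := Finset.range 11) (s' := fun k => Finset.range (k + 1))
    (by intro i k; simp only [Finset.mem_range, Finset.mem_Icc]; omega)]
  refine Finset.sum_congr rfl fun k _ => ?_
  rw [integral_finsetSum _ fun i _ => (hI (k - i) i).const_mul _]
  refine Finset.sum_congr rfl fun i _ => ?_
  rw [integral_const_mul, integral_mul_const]
  ring

lemma Params.IsOU.h_eq (hW : IsBrownianPair 𝓕 P W W') (hX : θ.IsOU 𝓕 P W X)
    (hT : 0 < T ∨ 0 < θ.α₀) (Δ : ℝ≥0) (x : ℝ) :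
    θ.h P X T Δ x = 100 ^ 2 / (Δ : ℝ) *
      ∫ u in Set.Ioc T (T + Δ), θ.forwardVariance P X T u x ∂timeMeasure := by
  rw [hX.integral_forwardVariance hW hT, Params.h]

lemma Params.IsOU.h_nonneg (hW : IsBrownianPair 𝓕 P W W') (hX : θ.IsOU 𝓕 P W X)
    (hT : 0 < T ∨ 0 < θ.α₀) (Δ : ℝ≥0) (x : ℝ) : 0 ≤ θ.h P X T Δ x := by
  rw [hX.h_eq hW hT]
  exact mul_nonneg (by positivity) (setIntegral_nonneg measurableSet_Ioc
    fun u hu => hX.forwardVariance_nonneg hW hu.1.le x)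

lemma Params.continuous_h (θ : Params) (P : Measure Ω) (X : ℝ≥0 → Ω → ℝ) (T Δ : ℝ≥0) :
    Continuous (θ.h P X T Δ) := by
  unfold Params.h
  fun_prop

lemma Params.IsOU.isForwardVariance (hW : IsBrownianPair 𝓕 P W W') (hX : θ.IsOU 𝓕 P W X)
    (hT : 0 < T ∨ 0 < θ.α₀) (Δ : ℝ≥0) :
    IsForwardVariance 𝓕 P (θ.σ P X) T Δ fun u ω => θ.forwardVariance P X T u (X T ω) :=
  ⟨(hX.integrable_forwardVariance hW hT _).aestronglyMeasurable,
    fun _ hu => (hX.condExp_σ_sq hW hu).symm⟩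

/-- For each `u` the versions agree off a null set depending on `u`; joint measurability and Fubini
exchange the quantifiers. -/
lemma IsForwardVariance.ae_ae_eq {ξ ξ' : ℝ≥0 → Ω → ℝ} {σ : ℝ≥0 → Ω → ℝ}
    (h : IsForwardVariance 𝓕 P σ T Δ ξ) (h' : IsForwardVariance 𝓕 P σ T Δ ξ') :
    ∀ᵐ ω ∂P, ∀ᵐ u ∂(timeMeasure.restrict (Set.Ioc T (T + Δ))), ξ u ω = ξ' u ω := by
  refine ae_ae_swap_of_ae_prod (q := fun z => ξ z.1 z.2 = ξ' z.1 z.2)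
    (ae_eq_prod_of_ae_ae_eq h.1 h'.1 ?_)
  filter_upwards [ae_restrict_mem measurableSet_Ioc] with u hu
  exact (h.2 u hu.1.le).trans (h'.2 u hu.1.le).symm

/-- Fubini on each side reduces this to a fixed `u`, where it is the defining property of the
conditional expectation on `A`. -/
lemma setIntegral_integral_σ_sq (hW : IsBrownianPair 𝓕 P W W') (hX : θ.IsOU 𝓕 P W X)
    (hT : 0 < T ∨ 0 < θ.α₀) {b : ℝ≥0}
    (hσ : Integrable (fun z : ℝ≥0 × Ω => θ.σ P X z.1 z.2 ^ 2)
      ((timeMeasure.restrict (Set.Ioc T b)).prod P)) {A : Set Ω} (hA : MeasurableSet[𝓕 T] A) :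
    ∫ ω in A, ∫ u in Set.Ioc T b, θ.σ P X u ω ^ 2 ∂timeMeasure ∂P
      = ∫ ω in A, ∫ u in Set.Ioc T b, θ.forwardVariance P X T u (X T ω) ∂timeMeasure ∂P := by
  have hle : (timeMeasure.restrict (Set.Ioc T b)).prod (P.restrict A)
      ≤ (timeMeasure.restrict (Set.Ioc T b)).prod P :=
    Measure.prod_mono le_rfl Measure.restrict_le_self
  have h1 := integral_integral_swap (f := fun u ω => θ.σ P X u ω ^ 2) (hσ.mono_measure hle)
  have h2 := integral_integral_swap (f := fun u ω => θ.forwardVariance P X T u (X T ω))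
    ((hX.integrable_forwardVariance hW hT b).mono_measure hle)
  rw [← h1, ← h2]
  refine setIntegral_congr_fun measurableSet_Ioc fun u hu => ?_
  rw [← setIntegral_condExp (𝓕.le T) (hX.integrable_σ_sq hW u) hA]
  exact integral_congr_ae (ae_restrict_of_ae (hX.condExp_σ_sq hW hu.1.le))

/-- The log-contract: integrability, and the conditional expectation in terms of the forward
variance. -/
lemma integrable_log_and_condExp_log (hW : IsBrownianPair 𝓕 P W W') (hX : θ.IsOU 𝓕 P W X)
    (hS : θ.IsStockPrice 𝓕 P W W' X S) (hT : 0 < T ∨ 0 < θ.α₀) (Δ : ℝ≥0) :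
    Integrable (fun ω => Real.log (S (T + Δ) ω / S T ω)) P ∧
    P[fun ω => Real.log (S (T + Δ) ω / S T ω) | 𝓕 T] =ᵐ[P] fun ω =>
      -(1 / 2) * ∫ u in Set.Ioc T (T + Δ), θ.forwardVariance P X T u (X T ω) ∂timeMeasure := by
  obtain ⟨S₀, M, hS₀, hM, hSM⟩ := hS
  have hTb : T ≤ T + Δ := le_self_add
  -- Joint integrability of `σ²` is part of the existence of the Itô integral `M`.
  have hσ : Integrable (fun z : ℝ≥0 × Ω => θ.σ P X z.1 z.2 ^ 2)
      ((timeMeasure.restrict (Set.Ioc 0 (T + Δ))).prod P) := (hM (T + Δ)).1.integrable_sq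
  have hσT : Integrable (fun z : ℝ≥0 × Ω => θ.σ P X z.1 z.2 ^ 2)
      ((timeMeasure.restrict (Set.Ioc T (T + Δ))).prod P) :=
    hσ.mono_measure (Measure.prod_mono
      (Measure.restrict_mono_set _ (Set.Ioc_subset_Ioc_left zero_le)) le_rfl)
  have hIσ : Integrable (fun ω => ∫ u in Set.Ioc T (T + Δ), θ.σ P X u ω ^ 2 ∂timeMeasure) P :=
    hσT.integral_prod_right
  have hMi (t : ℝ≥0) : Integrable (M t) P := (hM t).2.1.integrable one_le_two
  have hIF : Integrable (fun ω => ∫ u in Set.Ioc T (T + Δ),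
      θ.forwardVariance P X T u (X T ω) ∂timeMeasure) P :=
    (hX.integrable_forwardVariance hW hT (T + Δ)).integral_prod_right
  have hlog : (fun ω => Real.log (S (T + Δ) ω / S T ω)) =ᵐ[P] fun ω => (M (T + Δ) ω - M T ω)
      - 1 / 2 * ∫ u in Set.Ioc T (T + Δ), θ.σ P X u ω ^ 2 ∂timeMeasure := by
    filter_upwards [hSM (T + Δ), hSM T, hσ.prod_left_ae] with ω h1 h2 h3
    have hsplit : ∫ u in Set.Ioc 0 (T + Δ), θ.σ P X u ω ^ 2 ∂timeMeasure
        = (∫ u in Set.Ioc 0 T, θ.σ P X u ω ^ 2 ∂timeMeasure)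
          + ∫ u in Set.Ioc T (T + Δ), θ.σ P X u ω ^ 2 ∂timeMeasure := by
      rw [← Set.Ioc_union_Ioc_eq_Ioc zero_le hTb]
      exact setIntegral_union (Set.Ioc_disjoint_Ioc_of_le le_rfl) measurableSet_Ioc
        (IntegrableOn.mono_set h3 (Set.Ioc_subset_Ioc_right hTb))
        (IntegrableOn.mono_set h3 (Set.Ioc_subset_Ioc_left zero_le))
    rw [h1, h2, mul_div_mul_left _ _ hS₀.ne', ← Real.exp_sub, Real.log_exp, hsplit]
    ring
  have hint : Integrable (fun ω => Real.log (S (T + Δ) ω / S T ω)) P :=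
    (((hMi _).sub (hMi _)).sub (hIσ.const_mul _)).congr hlog.symm
  refine ⟨hint, (ae_eq_condExp_of_forall_setIntegral_eq (𝓕.le T) hint
    (fun A _ _ => (hIF.const_mul _).integrableOn) (fun A hA _ => ?_) ?_).symm⟩
  · have hm : ∫ ω in A, (M (T + Δ) ω - M T ω) ∂P = 0 := by
      rw [integral_sub (hMi _).integrableOn (hMi _).integrableOn,
        (hM (T + Δ)).setIntegral_eq (hW.hasBrownianIncrements_mixedBM θ) zero_le hTb (hM T) hA,
        sub_self]
    have hdM : Integrable (fun ω => M (T + Δ) ω - M T ω) P := (hMi _).sub (hMi _)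
    rw [integral_congr_ae (ae_restrict_of_ae hlog), integral_sub
      hdM.integrableOn (hIσ.const_mul (1 / 2)).integrableOn, hm,
      integral_const_mul, integral_const_mul, setIntegral_integral_σ_sq hW hX hT hσT hA]
    ring
  -- The candidate is a continuous function of `X T`, itself a.e. equal to an `𝓕 T`-measurable
  -- function.
  · simp only [hX.integral_forwardVariance hW hT]
    have hc : Continuous fun x : ℝ =>
        -(1 / 2) * ∑ i ∈ Finset.range 11, θ.β P X T Δ i * x ^ i := by fun_prop
    exact hc.comp_aestronglyMeasurable (hX.aestronglyMeasurable hW T)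

lemma vixSq_ae_eq_h (hW : IsBrownianPair 𝓕 P W W') (hX : θ.IsOU 𝓕 P W X)
    (hS : θ.IsStockPrice 𝓕 P W W' X S) (hT : 0 < T ∨ 0 < θ.α₀) (Δ : ℝ≥0) :
    ∀ᵐ ω ∂P, vixSq 𝓕 P S T Δ ω = θ.h P X T Δ (X T ω) := by
  filter_upwards [(integrable_log_and_condExp_log hW hX hS hT Δ).2] with ω hω
  rw [vixSq, hω, hX.h_eq hW hT]
  ring

end VIX

/-! ### Expectations of functions of a Gaussian variable. -/

section Pricing

variable {P : Measure Ω} {Y : Ω → ℝ} {v : ℝ}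

lemma integrable_gaussianReal_standard_iff (f : ℝ → ℝ) :
    Integrable f (gaussianReal 0 1) ↔ Integrable fun x => f x * Real.exp (-x ^ 2 / 2) := by
  rw [gaussianReal_of_var_ne_zero 0 one_ne_zero,
    integrable_withDensity_iff_integrable_smul' (measurable_gaussianPDF 0 1)
      (ae_of_all _ fun _ => gaussianPDF_lt_top)]
  have hc : (Real.sqrt (2 * Real.pi))⁻¹ ≠ 0 := by positivity
  have e : (fun x => (gaussianPDF 0 1 x).toReal • f x)
      = fun x => (Real.sqrt (2 * Real.pi))⁻¹ * (f x * Real.exp (-x ^ 2 / 2)) := by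
    ext x
    simp [toReal_gaussianPDF, gaussianPDFReal]
    ring
  rw [e]
  exact integrable_const_mul_iff (isUnit_iff_ne_zero.mpr hc) _

lemma map_eq_map_standard (hv : 0 ≤ v) (hY : HasLaw Y (gaussianReal 0 v.toNNReal) P) :
    P.map Y = (gaussianReal 0 1).map (fun x => Real.sqrt v * x) := by
  rw [hY.map_eq, gaussianReal_eq_map_standard hv]

lemma integrable_comp_gaussian_iff (hv : 0 ≤ v) (hY : HasLaw Y (gaussianReal 0 v.toNNReal) P)
    {f : ℝ → ℝ} (hf : Measurable f) :
    Integrable (fun ω => f (Y ω)) P ↔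
      Integrable fun x => f (Real.sqrt v * x) * Real.exp (-x ^ 2 / 2) := by
  rw [← integrable_gaussianReal_standard_iff (fun x => f (Real.sqrt v * x))]
  refine (integrable_map_measure hf.aestronglyMeasurable hY.aemeasurable).symm.trans ?_
  rw [map_eq_map_standard hv hY]
  exact integrable_map_measure hf.aestronglyMeasurable (by fun_prop)

lemma integral_comp_gaussian (hv : 0 ≤ v) (hY : HasLaw Y (gaussianReal 0 v.toNNReal) P)
    {f : ℝ → ℝ} (hf : Measurable f) :
    ∫ ω, f (Y ω) ∂P = 1 / Real.sqrt (2 * Real.pi) *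
      ∫ x, f (Real.sqrt v * x) * Real.exp (-x ^ 2 / 2) := by
  rw [← integral_gaussianReal_standard (fun x => f (Real.sqrt v * x)),
    ← integral_map hY.aemeasurable hf.aestronglyMeasurable, map_eq_map_standard hv hY,
    integral_map (by fun_prop) hf.aestronglyMeasurable]

end Pricing

end QuinticOU

end

theorem mainTheorem2 {Ω : Type*} {mΩ : MeasurableSpace Ω} (P : Measure Ω)
    [IsProbabilityMeasure P] (𝓕 : Filtration ℝ≥0 mΩ) (θ : QuinticOU.Params)
    (W W' X S : ℝ≥0 → Ω → ℝ) (hW : QuinticOU.IsBrownianPair 𝓕 P W W')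
    (hX : θ.IsOU 𝓕 P W X) (hS : θ.IsStockPrice 𝓕 P W W' X S)
    (T Δ : ℝ≥0) (hΔ : 0 < Δ) (hT : 0 < T ∨ 0 < θ.α₀) :
    -- decomposition of `X_u`, the Gaussian increment and its moments
    (∀ u : ℝ≥0, T ≤ u →
      QuinticOU.IsItoIntegral 𝓕 P W T u (fun s _ => θ.kernel u s) (θ.G X T u) ∧
      Indep (MeasurableSpace.comap (θ.G X T u) inferInstance) (𝓕 T) P ∧
      HasLaw (θ.G X T u) (gaussianReal 0 (Real.toNNReal (θ.variance ((u : ℝ) - T)))) P ∧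
      ∀ m : ℕ, ∫ ω, θ.G X T u ω ^ m ∂P =
        QuinticOU.gaussianMoment (θ.variance ((u : ℝ) - T)) m) ∧
    -- the forward variance is an explicit polynomial in `X_T`
    (∀ u : ℝ≥0, T ≤ u →
      0 < θ.g P X u ∧ Integrable (fun ω => θ.σ P X u ω ^ 2) P ∧
      ∀ᵐ ω ∂P, (P[fun ω' => θ.σ P X u ω' ^ 2 | 𝓕 T]) ω =
        θ.ξ₀ u / θ.g P X u * ∑ k ∈ Finset.range 11, ∑ i ∈ Finset.range (k + 1),
          θ.conv k * (k.choose i : ℝ) *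
            (X T ω * Real.exp (-θ.speed * ((u : ℝ) - T))) ^ i *
            ∫ ω', θ.G X T u ω' ^ (k - i) ∂P) ∧
    -- the squared VIX: log-contract, integrated forward variance, and polynomial in `X_T`
    Integrable (fun ω => Real.log (S (T + Δ) ω / S T ω)) P ∧
    (∃ ξ : ℝ≥0 → Ω → ℝ, QuinticOU.IsForwardVariance 𝓕 P (θ.σ P X) T Δ ξ) ∧
    (∀ ξ : ℝ≥0 → Ω → ℝ, QuinticOU.IsForwardVariance 𝓕 P (θ.σ P X) T Δ ξ →
      ∀ᵐ ω ∂P, IntegrableOn (fun u => ξ u ω) (Set.Ioc T (T + Δ)) QuinticOU.timeMeasure ∧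
        QuinticOU.vixSq 𝓕 P S T Δ ω =
          100 ^ 2 / (Δ : ℝ) * ∫ u in Set.Ioc T (T + Δ), ξ u ω ∂QuinticOU.timeMeasure) ∧
    (∀ m i : ℕ, IntegrableOn (θ.βIntegrand P X T m i) (Set.Ioc T (T + Δ))
      QuinticOU.timeMeasure) ∧
    (∀ᵐ ω ∂P, QuinticOU.vixSq 𝓕 P S T Δ ω =
      100 ^ 2 / (Δ : ℝ) * ∑ i ∈ Finset.range 11, θ.β P X T Δ i * X T ω ^ i) ∧
    -- pricing of VIX derivatives
    (∀ x : ℝ, 0 ≤ θ.h P X T Δ x) ∧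
    HasLaw (X T) (gaussianReal 0 (Real.toNNReal (θ.variance T))) P ∧
    (∀ Φ : ℝ → ℝ, Measurable Φ →
      (Integrable (fun ω => Φ (QuinticOU.vix 𝓕 P S T Δ ω)) P ↔
        Integrable (fun x : ℝ =>
          Φ (Real.sqrt (θ.h P X T Δ (Real.sqrt (θ.variance T) * x))) *
            Real.exp (-x ^ 2 / 2))) ∧
      ∫ ω, Φ (QuinticOU.vix 𝓕 P S T Δ ω) ∂P =
        ∫ ω, Φ (Real.sqrt (θ.h P X T Δ (X T ω))) ∂P ∧
      ∫ ω, Φ (Real.sqrt (θ.h P X T Δ (X T ω))) ∂P =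
        1 / Real.sqrt (2 * Real.pi) *
          ∫ x : ℝ, Φ (Real.sqrt (θ.h P X T Δ (Real.sqrt (θ.variance T) * x))) *
            Real.exp (-x ^ 2 / 2)) := by
  have hvs := QuinticOU.vixSq_ae_eq_h hW hX hS hT Δ
  have hv := θ.variance_nonneg T.coe_nonneg
  have hlaw := hX.hasLaw hW T
  have hvix : ∀ᵐ ω ∂P, QuinticOU.vix 𝓕 P S T Δ ω = Real.sqrt (θ.h P X T Δ (X T ω)) := by
    filter_upwards [hvs] with ω hω
    rw [QuinticOU.vix, hω]
  refine ⟨fun u hu => ⟨hX.isItoIntegral_G hW hu, hX.indep_G hW hu, hX.hasLaw_G hW hu,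
    hX.integral_G_pow hW hu⟩, fun u hu => ⟨hX.g_pos hW (hT.imp_left fun h => h.trans_le hu),
    hX.integrable_σ_sq hW u, ?_⟩, (QuinticOU.integrable_log_and_condExp_log hW hX hS hT Δ).1,
    ⟨_, hX.isForwardVariance hW hT Δ⟩, fun ξ hξ => ?_, hX.integrableOn_βIntegrand hW hT (T + Δ),
    hvs, hX.h_nonneg hW hT Δ, hlaw, fun Φ hΦ => ?_⟩
  · filter_upwards [hX.condExp_σ_sq hW hu] with ω hω
    rw [hω, θ.forwardVariance_eq]
  · filter_upwards [hvs, hξ.ae_ae_eq (hX.isForwardVariance hW hT Δ)] with ω h1 h2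
    refine ⟨(hX.integrable_forwardVariance_left hW hT (T + Δ) (X T ω)).congr
      (h2.mono fun _ h => h.symm), ?_⟩
    rw [h1, hX.h_eq hW hT, integral_congr_ae h2]
  · have hf : Measurable fun x => Φ (Real.sqrt (θ.h P X T Δ x)) :=
      hΦ.comp (θ.continuous_h P X T Δ).measurable.sqrt
    have hae : (fun ω => Φ (QuinticOU.vix 𝓕 P S T Δ ω))
        =ᵐ[P] fun ω => Φ (Real.sqrt (θ.h P X T Δ (X T ω))) :=
      hvix.mono fun ω hω => congrArg Φ hω
    -- The two integral identities hold without integrability: by the equivalence all sides then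
    -- take the default value `0`.
    exact ⟨(integrable_congr hae).trans (QuinticOU.integrable_comp_gaussian_iff hv hlaw hf),
      integral_congr_ae hae, QuinticOU.integral_comp_gaussian hv hlaw hf⟩
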